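/- Let $K$ be an algebraically closed field of characteristic zero and $\ell$ a finite-dimensional Lie algebra over $K$, with basis $\{u\}$ and dual basis $\{u'\}$ of $\ell'=\mathrm{Hom}(\ell,K)$. Let $W\ell=S\ell'\otimes\wedge\ell'$ be the classical Weil algebra, with the differential $d$ of Lie algebra cohomology with coefficients in $S\ell'$, $d=\sum_u\theta_S(u)\otimes u'+\frac12\sum_u 1\otimes u'\,\theta_\wedge(u)$ ($\theta_S,\theta_\wedge$ the coadjoint actions by derivations), and the Koszul differential $h=\sum_u u'\otimes\iota(u)$. Let $W^{\infty/2}\tilde\ell$ be the semi-infinite Weil complex of the loop algebra $\tilde\ell=\ell\otimes K[t,t^{-1}]$: the tensor product of the Fock module of the Weyl algebra generated by $\beta^x_n,\gamma^f_n$ and the Fock module of the Clifford algebra generated by $b^x_n,c^f_n$ ($x\in\ell$, $f\in\ell'$, $n\in\mathbb Z$), whose only nonzero (anti)commutators are $c^f_nb^x_m+b^x_mc^f_n=\gamma^f_n\beta^x_m-\beta^x_m\gamma^f_n=\langle f,x\rangle\delta_{m+n,0}$; the modules are generated by a vacuum $\mathbf 1$ killed by $b_n,\beta_n$ with $n\ge0$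 and $c_n,\gamma_n$ with $n\ge1$, and have as bases the monomials in the remaining generators applied to the vacuum. Regard $W\ell$ as the span of the monomials in the $\gamma_0^{u'}$ and $c_0^{u'}$ applied to $\mathbf 1$. With normal ordering $:\ :$, define on $W^{\infty/2}\tilde\ell$ $$L_0=-\sum_{u,m}m:b^u_mc^{u'}_{-m}:-\sum_{u,m}m:\beta^u_m\gamma^{u'}_{-m}:,$$ $$Q=\sum_{u,v,i,j}:\beta_{i+j}^{[u,v]}\gamma_{-i}^{v'}c_{-j}^{u'}:+\tfrac12\sum_{u,v,i,j}:b_{i+j}^{[u,v]}c_{-i}^{v'}c_{-j}^{u'}:,$$ $$h=\sum_{u,n}\gamma_{-n}^{u'}b_n^u,\qquad k=\sum_{u,n}n\,\beta_n^uc_{-n}^{u'}.$$ The degree is the eigenvalue of $L_0$. Then these sums are well defined (on each vector only finitely many terms are nonzero), $d$, $Q$, $k$ and both operators $h$ are square-zero, the degree-zero part $W^{\infty/2}\tilde\ell|_{\deg=0}$ is $W\ell$, and: 1. $Q$ preserves the degree-zero part and the inclusion of $W\ell$ induces an isomorphism $H(W\ell,d)\cong H(W^{\infty/2}\tilde\ell|_{\deg=0},Q)$.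 Moreover $L_0$ commutes with $Q$, and the inclusion identifies $H(W\ell,d)$ with the degree-zero part of $H(W^{\infty/2}\tilde\ell,Q)$. 2. $H(W^{\infty/2}\tilde\ell,h)=H(W\ell,h)=K$: the inclusion of $W\ell$ induces an isomorphism of the two cohomologies, and each of them is one-dimensional, spanned by the class of $1\in W\ell$ (resp. of $\mathbf 1$). 3. $H(W^{\infty/2}\tilde\ell,k)=W\ell$: $k$ vanishes on $W\ell$, and sending an element of $W\ell$ to its class is a bijection from $W\ell$ to $H(W^{\infty/2}\tilde\ell,k)$. -/

import Mathlib

open scoped TensorProduct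

noncomputable section

namespace VOWA

/-! ### Cohomology of a vector space with an endomorphism -/

section Cohomology

variable {K : Type*} [Field K] {V W : Type*} [AddCommGroup V] [Module K V]
  [AddCommGroup W] [Module K W]

/-- `H(V, D) = ker D / (im D ∩ ker D)`; for a square-zero `D` this is `ker D / im D`. -/
abbrev Cohomology (D : Module.End K V) : Type _ :=
  LinearMap.ker D ⧸ (LinearMap.range D).submoduleOf (LinearMap.ker D)

/-- The cohomology class of a cocycle. -/
def Cohomology.mk (D : Module.End K V) (z : V) (hz : D z = 0) : Cohomology D :=
  Submodule.Quotient.mk ⟨z, hz⟩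

/-- The map `H(V, D) → H(W, E)`, `[z] ↦ [f z]`, induced by a linear map `f` with `E f = f D`. -/
def cohomologyMap {D : Module.End K V} {E : Module.End K W} (f : V →ₗ[K] W)
    (hf : E ∘ₗ f = f ∘ₗ D) : Cohomology D →ₗ[K] Cohomology E :=
  Submodule.mapQ _ _
    (f.restrict (p := LinearMap.ker D) (q := LinearMap.ker E) (fun z hz => by
      have h := LinearMap.congr_fun hf z
      simp only [LinearMap.comp_apply] at h
      rw [LinearMap.mem_ker] at hz ⊢
      rw [h, hz, map_zero]))
    (by
      rintro ⟨z, hz⟩ ⟨y, hy⟩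
      exact ⟨f y, by
        have h := LinearMap.congr_fun hf y
        simp only [LinearMap.comp_apply] at h
        rw [h, hy]; rfl⟩)

end Cohomology

/-! ### Infinite sums of operators -/

section LocalSum

variable {K : Type*} [Field K] {V : Type*} [AddCommGroup V] [Module K V] {α : Type*}

/-- Every vector is killed by all but finitely many of the operators. -/
def IsLocallyFinite (T : α → Module.End K V) : Prop :=
  ∀ w : V, {a | T a w ≠ 0}.Finite

open Classical in
/-- The sum `w ↦ ∑ a, T a w` of a locally finite family of operators (`0` if the family is not
locally finite). -/
def localSum (T : α → Module.End K V) : Module.End K V :=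
  if hT : IsLocallyFinite T then
    { toFun := fun w => ∑ᶠ a, T a w
      map_add' := fun v w => by
        simp only [map_add]
        exact finsum_add_distrib (hT v) (hT w)
      map_smul' := fun c w => by
        simp only [map_smul, RingHom.id_apply]
        exact (smul_finsum' c (hT w)).symm }
  else 0

end LocalSum

/-! ### Derivations of a symmetric algebra -/

section SymDer

variable {K : Type*} [Field K] {V : Type*} [AddCommMonoid V] [Module K V]

/-- The algebra map `p ↦ p + ε D(p)` that encodes the derivation extending `f`. -/
def symDerAux (f : V →ₗ[K] SymmetricAlgebra K V) :
    SymmetricAlgebra K V →ₐ[K] TrivSqZeroExt (SymmetricAlgebra K V) (SymmetricAlgebra K V) :=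
  SymmetricAlgebra.lift
    ((TrivSqZeroExt.inlAlgHom K (SymmetricAlgebra K V) (SymmetricAlgebra K V)).toLinearMap ∘ₗ
        SymmetricAlgebra.ι K V +
      (TrivSqZeroExt.inrHom (SymmetricAlgebra K V) (SymmetricAlgebra K V)).restrictScalars K ∘ₗ f)

theorem fst_symDerAux (f : V →ₗ[K] SymmetricAlgebra K V) (p : SymmetricAlgebra K V) :
    (symDerAux f p).fst = p := by
  have h : (TrivSqZeroExt.fstHom K (SymmetricAlgebra K V) (SymmetricAlgebra K V)).comp
      (symDerAux f) = AlgHom.id K _ := by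
    apply SymmetricAlgebra.algHom_ext
    ext v
    simp [symDerAux]
  exact DFunLike.congr_fun h p

/-- The unique derivation of the symmetric algebra of `V` that extends `f` on generators. -/
def symDer (f : V →ₗ[K] SymmetricAlgebra K V) :
    Derivation K (SymmetricAlgebra K V) (SymmetricAlgebra K V) :=
  Derivation.mk'
    ((TrivSqZeroExt.sndHom (SymmetricAlgebra K V) (SymmetricAlgebra K V)).restrictScalars K ∘ₗ
      (symDerAux f).toLinearMap)
    (fun a b => by simp [fst_symDerAux, mul_comm])

theorem symDer_ι (f : V →ₗ[K] SymmetricAlgebra K V) (v : V) :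
    symDer f (SymmetricAlgebra.ι K V v) = f v := by
  simp [symDer, symDerAux]

/-- The contraction of the symmetric algebra of `V` by a linear form `φ`: the derivation
with value `φ v` at `v`. -/
def symContract (φ : Module.Dual K V) : Module.End K (SymmetricAlgebra K V) :=
  (symDer (φ.smulRight (1 : SymmetricAlgebra K V))).toLinearMap

/-- Multiplication by `v` on the symmetric algebra. -/
def symMul (v : V) : Module.End K (SymmetricAlgebra K V) :=
  LinearMap.mulLeft K (SymmetricAlgebra.ι K V v)

end SymDer

section ExtDer

variable {K : Type*} [Field K] {V : Type*} [AddCommGroup V] [Module K V]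

/-- The contraction of the exterior algebra of `V` by a linear form `φ`: the superderivation
with value `φ v` at `v`. -/
def extContract (φ : Module.Dual K V) : Module.End K (ExteriorAlgebra K V) :=
  CliffordAlgebra.contractLeft φ

/-- Left multiplication by `v` on the exterior algebra. -/
def extMul (v : V) : Module.End K (ExteriorAlgebra K V) :=
  LinearMap.mulLeft K (ExteriorAlgebra.ι K v)

end ExtDer

variable (K : Type*) [Field K] (ℓ : Type*) [LieRing ℓ] [LieAlgebra K ℓ]

/-! ### The classical Weil algebra -/

/-- The classical Weil algebra `Wℓ = Sℓ' ⊗ Λℓ'`. -/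
abbrev ClassicalWeil : Type _ :=
  SymmetricAlgebra K (Module.Dual K ℓ) ⊗[K] ExteriorAlgebra K (Module.Dual K ℓ)

section Classical

variable {K ℓ}

/-- The action of `x` on `Sℓ'` by the derivation that extends the coadjoint action on `ℓ'`. -/
def thetaSym (x : ℓ) : Module.End K (SymmetricAlgebra K (Module.Dual K ℓ)) :=
  (symDer (SymmetricAlgebra.ι K (Module.Dual K ℓ) ∘ₗ
    (LieModule.toEnd K ℓ (Module.Dual K ℓ) x))).toLinearMap

variable {ι : Type*} [Fintype ι] (B : Module.Basis ι K ℓ)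

/-- The action of `x` on `Λℓ'` by the derivation that extends the coadjoint action on `ℓ'`:
each factor `v'` is replaced in turn by `ad'(x) v'`. -/
def thetaExt (x : ℓ) : Module.End K (ExteriorAlgebra K (Module.Dual K ℓ)) :=
  ∑ v, extMul ⁅x, B.coord v⁆ ∘ₗ extContract (Module.Dual.eval K ℓ (B v))

/-- The differential `d` on `Wℓ` whose cohomology is the Lie algebra cohomology of `ℓ` with
coefficients in `Sℓ'`: `d = ∑ u, θ(u) ⊗ u' + 1/2 ∑ u, 1 ⊗ u' θ(u)`. -/
def classicalD : Module.End K (ClassicalWeil K ℓ) :=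
  ∑ u, TensorProduct.map (thetaSym (B u)) (extMul (B.coord u)) +
    (1 / 2 : K) • ∑ u, TensorProduct.map LinearMap.id (extMul (B.coord u) ∘ₗ thetaExt B (B u))

/-- The Koszul differential on `Wℓ`, which replaces an exterior generator by the corresponding
symmetric one: `h = ∑ u, u' ⊗ i(u)`. -/
def classicalH : Module.End K (ClassicalWeil K ℓ) :=
  ∑ u, TensorProduct.map (symMul (B.coord u)) (extContract (Module.Dual.eval K ℓ (B u)))

end Classical

/-! ### The semi-infinite Weil complex of the loop algebra -/

/-- The span of the creation operators of one statistics: `(f ↦ m)` in the first component stands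
for the mode `-m` of type `γ` (or `c`), i.e. `m = 0, 1, 2, …`; and `(x ↦ m)` in the second
component for the mode `-m-1` of type `β` (or `b`). -/
abbrev Creation : Type _ := (ℕ →₀ Module.Dual K ℓ) × (ℕ →₀ ℓ)

/-- The semi-infinite symmetric module: the Fock module of the Weyl algebra, with basis the
commuting monomials in the creation operators applied to the vacuum. -/
abbrev SymModule : Type _ := SymmetricAlgebra K (Creation K ℓ)

/-- The semi-infinite exterior module: the Fock module of the Clifford algebra, with basis the
anticommuting monomials in the creation operators applied to the vacuum. -/
abbrev ExtModule : Type _ := ExteriorAlgebra K (Creation K ℓ)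

/-- The semi-infinite Weil complex `W^{∞/2}ℓ̃ = S^{∞/2}ℓ̃' ⊗ Λ^{∞/2}ℓ̃'`. -/
abbrev SemiInfWeil : Type _ := SymModule K ℓ ⊗[K] ExtModule K ℓ

/-- The vacuum vector. -/
def vacuum : SemiInfWeil K ℓ := 1 ⊗ₜ[K] 1

section Modes

variable {K ℓ}

/-- The creation operator `γ_{-m}^f` (or `c_{-m}^f`). -/
def createDual (f : Module.Dual K ℓ) (m : ℕ) : Creation K ℓ := (Finsupp.single m f, 0)

variable (K) in
/-- The creation operator `β_{-m-1}^x` (or `b_{-m-1}^x`). -/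
def createVec (x : ℓ) (m : ℕ) : Creation K ℓ := (0, Finsupp.single m x)

variable (K) in
/-- The pairing of `x_m`, `m ≥ 0`, with the creation operators: `γ_{-m}^f ↦ ⟨f, x⟩`. -/
def pairVec (x : ℓ) (m : ℕ) : Module.Dual K (Creation K ℓ) :=
  Module.Dual.eval K ℓ x ∘ₗ Finsupp.lapply m ∘ₗ LinearMap.fst K _ _

/-- The pairing of `f_{m+1}`, `m ≥ 0`, with the creation operators: `β_{-m-1}^x ↦ ⟨f, x⟩`. -/
def pairDual (f : Module.Dual K ℓ) (m : ℕ) : Module.Dual K (Creation K ℓ) :=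
  f ∘ₗ Finsupp.lapply m ∘ₗ LinearMap.snd K _ _

variable (K) in
/-- The operator `b_n^x` on the exterior module. -/
def bMode (x : ℓ) : ℤ → Module.End K (ExtModule K ℓ)
  | Int.ofNat m => extContract (pairVec K x m)
  | Int.negSucc m => extMul (createVec K x m)

/-- The operator `c_n^f` on the exterior module. -/
def cMode (f : Module.Dual K ℓ) (n : ℤ) : Module.End K (ExtModule K ℓ) :=
  match -n with
  | Int.ofNat m => extMul (createDual f m)
  | Int.negSucc m => extContract (pairDual f m)

variable (K) in
/-- The operator `β_n^x` on the symmetric module. -/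
def betaMode (x : ℓ) : ℤ → Module.End K (SymModule K ℓ)
  | Int.ofNat m => -symContract (pairVec K x m)
  | Int.negSucc m => symMul (createVec K x m)

/-- The operator `γ_n^f` on the symmetric module. -/
def gammaMode (f : Module.Dual K ℓ) (n : ℤ) : Module.End K (SymModule K ℓ) :=
  match -n with
  | Int.ofNat m => symMul (createDual f m)
  | Int.negSucc m => symContract (pairDual f m)

/-! Normal ordering: the annihilation operators are `b_n`, `β_n` with `n ≥ 0` and `c_n`, `γ_n` with
`n ≥ 1`. As operators of the same type (creation or annihilation) supercommute, and the `c`'s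
anticommute, it suffices to move the `b` or `β` to the right if it is an annihilation operator. -/

/-- `:β_m^x γ_n^f:` -/
def normalBetaGamma (x : ℓ) (m : ℤ) (f : Module.Dual K ℓ) (n : ℤ) :
    Module.End K (SymModule K ℓ) :=
  if 0 ≤ m then gammaMode f n ∘ₗ betaMode K x m else betaMode K x m ∘ₗ gammaMode f n

/-- `:b_m^x c_n^f:` -/
def normalBC (x : ℓ) (m : ℤ) (f : Module.Dual K ℓ) (n : ℤ) : Module.End K (ExtModule K ℓ) :=
  if 0 ≤ m then -(cMode f n ∘ₗ bMode K x m) else bMode K x m ∘ₗ cMode f n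

/-- `:b_m^x c_n^f c_p^g:` -/
def normalBCC (x : ℓ) (m : ℤ) (f : Module.Dual K ℓ) (n : ℤ) (g : Module.Dual K ℓ) (p : ℤ) :
    Module.End K (ExtModule K ℓ) :=
  if 0 ≤ m then cMode f n ∘ₗ cMode g p ∘ₗ bMode K x m
  else bMode K x m ∘ₗ cMode f n ∘ₗ cMode g p

variable {ι : Type*} (B : Module.Basis ι K ℓ)

/-- The terms `-m :b_m^u c_{-m}^{u'}:` of `L₀`. -/
def virTermBC (a : ι × ℤ) : Module.End K (SemiInfWeil K ℓ) :=
  TensorProduct.map LinearMap.id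
    (-(a.2 : K) • normalBC (B a.1) a.2 (B.coord a.1) (-a.2))

/-- The terms `-m :β_m^u γ_{-m}^{u'}:` of `L₀`. -/
def virTermBetaGamma (a : ι × ℤ) : Module.End K (SemiInfWeil K ℓ) :=
  TensorProduct.map (-(a.2 : K) • normalBetaGamma (B a.1) a.2 (B.coord a.1) (-a.2)) LinearMap.id

/-- The Virasoro operator `L₀`, whose eigenvalues are the degrees (weights). -/
def virZero : Module.End K (SemiInfWeil K ℓ) :=
  localSum (virTermBC B) + localSum (virTermBetaGamma B)

/-- The terms `:β_{i+j}^{[u,v]} γ_{-i}^{v'} c_{-j}^{u'}:` of `Q`. -/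
def qTermSym (a : (ι × ι) × (ℤ × ℤ)) : Module.End K (SemiInfWeil K ℓ) :=
  TensorProduct.map
    (normalBetaGamma ⁅B a.1.1, B a.1.2⁆ (a.2.1 + a.2.2) (B.coord a.1.2) (-a.2.1))
    (cMode (B.coord a.1.1) (-a.2.2))

/-- The terms `:b_{i+j}^{[u,v]} c_{-i}^{v'} c_{-j}^{u'}:` of `Q`. -/
def qTermExt (a : (ι × ι) × (ℤ × ℤ)) : Module.End K (SemiInfWeil K ℓ) :=
  TensorProduct.map LinearMap.id
    (normalBCC ⁅B a.1.1, B a.1.2⁆ (a.2.1 + a.2.2) (B.coord a.1.2) (-a.2.1)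
      (B.coord a.1.1) (-a.2.2))

/-- The semi-infinite cohomology differential
`Q = ∑ :β_{i+j}^{[u,v]} γ_{-i}^{v'} c_{-j}^{u'}: + 1/2 ∑ :b_{i+j}^{[u,v]} c_{-i}^{v'} c_{-j}^{u'}:`,
both sums over all `u, v, i, j`. -/
def semiInfQ : Module.End K (SemiInfWeil K ℓ) :=
  localSum (qTermSym B) + (1 / 2 : K) • localSum (qTermExt B)

/-- The terms `γ_{-n}^{u'} b_n^u` of `h`. -/
def hTerm (a : ι × ℤ) : Module.End K (SemiInfWeil K ℓ) :=
  TensorProduct.map (gammaMode (B.coord a.1) (-a.2)) (bMode K (B a.1) a.2)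

/-- The semi-infinite Koszul differential `h = ∑ γ_{-n}^{u'} b_n^u`. -/
def semiInfH : Module.End K (SemiInfWeil K ℓ) := localSum (hTerm B)

/-- The terms `n β_n^u c_{-n}^{u'}` of `k`. -/
def kTerm (a : ι × ℤ) : Module.End K (SemiInfWeil K ℓ) :=
  (a.2 : K) • TensorProduct.map (betaMode K (B a.1) a.2) (cMode (B.coord a.1) (-a.2))

/-- The homotopy operator `k = ∑ n β_n^u c_{-n}^{u'}`. -/
def semiInfK : Module.End K (SemiInfWeil K ℓ) := localSum (kTerm B)

end Modes

/-- The inclusion of `ℓ'` in the creation operators, `f ↦ γ_0^f` (or `c_0^f`). -/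
def zeroModes : Module.Dual K ℓ →ₗ[K] Creation K ℓ :=
  LinearMap.inl K _ _ ∘ₗ Finsupp.lsingle 0

/-- The classical Weil algebra inside the semi-infinite Weil complex, as the span of the monomials
in the `γ_0` and `c_0`. -/
def classicalInclusion : ClassicalWeil K ℓ →ₗ[K] SemiInfWeil K ℓ :=
  TensorProduct.map
    (SymmetricAlgebra.lift (SymmetricAlgebra.ι K (Creation K ℓ) ∘ₗ zeroModes K ℓ)).toLinearMap
    (ExteriorAlgebra.map (zeroModes K ℓ)).toLinearMap

/-! ### The Clifford and Weyl relations

The modes satisfy the defining relations of the Clifford and Weyl algebras, and the annihilation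
operators kill the vacuum, so that the modules above are the modules induced from the trivial
representation of the subalgebra generated by the annihilation operators. -/

section Relations

theorem extContract_extMul {K V : Type*} [Field K] [AddCommGroup V] [Module K V]
    (φ : Module.Dual K V) (v : V) (w : ExteriorAlgebra K V) :
    extContract φ (extMul v w) + extMul v (extContract φ w) = φ v • w := by
  simp only [extContract, extMul, LinearMap.mulLeft_apply]
  erw [CliffordAlgebra.contractLeft_ι_mul]
  exact sub_add_cancel _ _

theorem extMul_extMul {K V : Type*} [Field K] [AddCommGroup V] [Module K V]
    (v v' : V) (w : ExteriorAlgebra K V) :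
    extMul v (extMul v' w) + extMul v' (extMul v w) = 0 := by
  have := ExteriorAlgebra.ι_add_mul_swap (R := K) v v'
  simp only [extMul, LinearMap.mulLeft_apply, ← mul_assoc, ← add_mul, this, zero_mul]

theorem extContract_extContract {K V : Type*} [Field K] [AddCommGroup V] [Module K V]
    (φ ψ : Module.Dual K V) (w : ExteriorAlgebra K V) :
    extContract φ (extContract ψ w) + extContract ψ (extContract φ w) = 0 := by
  simp only [extContract]
  rw [CliffordAlgebra.contractLeft_comm]
  simp

theorem symContract_symMul {K V : Type*} [Field K] [AddCommMonoid V] [Module K V]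
    (φ : Module.Dual K V) (v : V) (w : SymmetricAlgebra K V) :
    symContract φ (symMul v w) - symMul v (symContract φ w) = φ v • w := by
  simp [symContract, symMul, symDer_ι, mul_comm]

theorem symMul_symMul {K V : Type*} [Field K] [AddCommMonoid V] [Module K V]
    (v v' : V) (w : SymmetricAlgebra K V) :
    symMul (K := K) v (symMul v' w) - symMul v' (symMul v w) = 0 := by
  simp [symMul, mul_left_comm]

theorem symContract_symContract {K V : Type*} [Field K] [AddCommMonoid V] [Module K V]
    (φ ψ : Module.Dual K V) (w : SymmetricAlgebra K V) :
    symContract φ (symContract ψ w) - symContract ψ (symContract φ w) = 0 := by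
  have : ⁅symDer (φ.smulRight (1 : SymmetricAlgebra K V)),
      symDer (ψ.smulRight (1 : SymmetricAlgebra K V))⁆ = 0 := by
    ext z
    induction z using SymmetricAlgebra.induction with
    | algebraMap r => simp
    | ι x => simp [Derivation.commutator_apply, symDer_ι]
    | mul a b ha hb => simp_all [Derivation.leibniz]
    | add a b ha hb => simp_all
  have := DFunLike.congr_fun this w
  rwa [Derivation.commutator_apply] at this

variable {K ℓ}

theorem cMode_neg_ofNat (f : Module.Dual K ℓ) (m : ℕ) :
    cMode f (-(Int.ofNat m)) = extMul (createDual f m) := by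
  unfold cMode; rw [neg_neg]

theorem cMode_neg_negSucc (f : Module.Dual K ℓ) (m : ℕ) :
    cMode f (-(Int.negSucc m)) = extContract (pairDual f m) := by
  unfold cMode; rw [neg_neg]

theorem gammaMode_neg_ofNat (f : Module.Dual K ℓ) (m : ℕ) :
    gammaMode f (-(Int.ofNat m)) = symMul (createDual f m) := by
  unfold gammaMode; rw [neg_neg]

theorem gammaMode_neg_negSucc (f : Module.Dual K ℓ) (m : ℕ) :
    gammaMode f (-(Int.negSucc m)) = symContract (pairDual f m) := by
  unfold gammaMode; rw [neg_neg]

theorem pairVec_createDual (f : Module.Dual K ℓ) (x : ℓ) (m n : ℕ) :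
    pairVec K x m (createDual f n) = if Int.ofNat m + -Int.ofNat n = 0 then f x else 0 := by
  by_cases h : n = m
  · subst h; simp [pairVec, createDual]
  · have h' : ¬ ((m : ℤ) + -(n : ℤ) = 0) := by omega
    simp [pairVec, createDual, h, h']

theorem pairDual_createVec (f : Module.Dual K ℓ) (x : ℓ) (m n : ℕ) :
    pairDual f n (createVec K x m) =
      if Int.negSucc m + -Int.negSucc n = 0 then f x else 0 := by
  by_cases h : m = n
  · subst h
    rw [if_pos (by omega)]; simp [pairDual, createVec]
  · rw [if_neg (by omega)]; simp [pairDual, createVec, h]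

theorem pairVec_createVec (x y : ℓ) (m n : ℕ) : pairVec K x m (createVec K y n) = 0 := by
  simp [pairVec, createVec]

theorem pairDual_createDual (f g : Module.Dual K ℓ) (m n : ℕ) :
    pairDual f m (createDual g n) = 0 := by
  simp [pairDual, createDual]

theorem cMode_bMode (f : Module.Dual K ℓ) (x : ℓ) (m n : ℤ) (w : ExtModule K ℓ) :
    cMode f n (bMode K x m w) + bMode K x m (cMode f n w) =
      (if m + n = 0 then f x else 0) • w := by
  obtain ⟨n, rfl⟩ : ∃ k, n = -k := ⟨-n, by simp⟩
  rcases n with n | n <;> rcases m with m | m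
  · rw [cMode_neg_ofNat, ← pairVec_createDual, add_comm]
    exact extContract_extMul _ _ _
  · rw [cMode_neg_ofNat, if_neg (by simp; omega), zero_smul]
    exact extMul_extMul _ _ _
  · rw [cMode_neg_negSucc, if_neg (by simp; omega), zero_smul]
    exact extContract_extContract _ _ _
  · rw [cMode_neg_negSucc, ← pairDual_createVec]
    exact extContract_extMul _ _ _

theorem bMode_bMode (x y : ℓ) (m n : ℤ) (w : ExtModule K ℓ) :
    bMode K x m (bMode K y n w) + bMode K y n (bMode K x m w) = 0 := by
  rcases n with n | n <;> rcases m with m | m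
  · exact extContract_extContract _ _ _
  · rw [add_comm]
    refine (extContract_extMul _ _ _).trans ?_
    rw [pairVec_createVec, zero_smul]
  · refine (extContract_extMul _ _ _).trans ?_
    rw [pairVec_createVec, zero_smul]
  · exact extMul_extMul _ _ _

theorem cMode_cMode (f g : Module.Dual K ℓ) (m n : ℤ) (w : ExtModule K ℓ) :
    cMode f m (cMode g n w) + cMode g n (cMode f m w) = 0 := by
  obtain ⟨n, rfl⟩ : ∃ k, n = -k := ⟨-n, by simp⟩
  obtain ⟨m, rfl⟩ : ∃ k, m = -k := ⟨-m, by simp⟩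
  rcases n with n | n <;> rcases m with m | m <;>
    simp only [cMode_neg_ofNat, cMode_neg_negSucc]
  · exact extMul_extMul _ _ _
  · rw [extContract_extMul, pairDual_createDual, zero_smul]
  · rw [add_comm, extContract_extMul, pairDual_createDual, zero_smul]
  · exact extContract_extContract _ _ _

theorem gammaMode_betaMode (f : Module.Dual K ℓ) (x : ℓ) (m n : ℤ) (w : SymModule K ℓ) :
    gammaMode f n (betaMode K x m w) - betaMode K x m (gammaMode f n w) =
      (if m + n = 0 then f x else 0) • w := by
  obtain ⟨n, rfl⟩ : ∃ k, n = -k := ⟨-n, by simp⟩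
  rcases n with n | n <;> rcases m with m | m
  · rw [gammaMode_neg_ofNat, ← pairVec_createDual]
    simp only [betaMode, LinearMap.neg_apply, map_neg, sub_neg_eq_add]
    rw [neg_add_eq_sub]
    exact symContract_symMul _ _ _
  · rw [gammaMode_neg_ofNat, if_neg (by simp; omega), zero_smul]
    exact symMul_symMul _ _ _
  · rw [gammaMode_neg_negSucc, if_neg (by simp; omega), zero_smul]
    simp only [betaMode, LinearMap.neg_apply, map_neg, sub_neg_eq_add]
    rw [neg_add_eq_sub]
    exact symContract_symContract _ _ _
  · rw [gammaMode_neg_negSucc, ← pairDual_createVec]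
    exact symContract_symMul _ _ _

theorem betaMode_betaMode (x y : ℓ) (m n : ℤ) (w : SymModule K ℓ) :
    betaMode K x m (betaMode K y n w) - betaMode K y n (betaMode K x m w) = 0 := by
  rcases n with n | n <;> rcases m with m | m <;>
    simp only [betaMode, LinearMap.neg_apply, map_neg, sub_neg_eq_add, neg_neg]
  · exact symContract_symContract _ _ _
  · rw [neg_add_eq_sub, symContract_symMul, pairVec_createVec, zero_smul]
  · rw [neg_add_eq_sub, ← neg_sub, symContract_symMul, pairVec_createVec, zero_smul, neg_zero]
  · exact symMul_symMul _ _ _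

theorem gammaMode_gammaMode (f g : Module.Dual K ℓ) (m n : ℤ) (w : SymModule K ℓ) :
    gammaMode f m (gammaMode g n w) - gammaMode g n (gammaMode f m w) = 0 := by
  obtain ⟨n, rfl⟩ : ∃ k, n = -k := ⟨-n, by simp⟩
  obtain ⟨m, rfl⟩ : ∃ k, m = -k := ⟨-m, by simp⟩
  rcases n with n | n <;> rcases m with m | m <;>
    simp only [gammaMode_neg_ofNat, gammaMode_neg_negSucc]
  · exact symMul_symMul _ _ _
  · rw [symContract_symMul, pairDual_createDual, zero_smul]
  · rw [← neg_sub, symContract_symMul, pairDual_createDual, zero_smul, neg_zero]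
  · exact symContract_symContract _ _ _

theorem bMode_one (x : ℓ) (n : ℤ) (hn : 0 ≤ n) : bMode K x n 1 = 0 := by
  obtain ⟨n, rfl⟩ := Int.eq_ofNat_of_zero_le hn
  exact CliffordAlgebra.contractLeft_one _ _

theorem betaMode_one (x : ℓ) (n : ℤ) (hn : 0 ≤ n) : betaMode K x n 1 = 0 := by
  obtain ⟨n, rfl⟩ := Int.eq_ofNat_of_zero_le hn
  exact neg_eq_zero.2 (Derivation.map_one_eq_zero _)

theorem cMode_one (f : Module.Dual K ℓ) (n : ℤ) (hn : 1 ≤ n) : cMode f n 1 = 0 := by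
  obtain ⟨n, rfl⟩ : ∃ k : ℕ, n = -Int.negSucc k := ⟨(n - 1).toNat, by omega⟩
  rw [cMode_neg_negSucc]
  exact CliffordAlgebra.contractLeft_one _ _

theorem gammaMode_one (f : Module.Dual K ℓ) (n : ℤ) (hn : 1 ≤ n) : gammaMode f n 1 = 0 := by
  obtain ⟨n, rfl⟩ : ∃ k : ℕ, n = -Int.negSucc k := ⟨(n - 1).toNat, by omega⟩
  rw [gammaMode_neg_negSucc]
  exact Derivation.map_one_eq_zero _

end Relations

end VOWA

end

noncomputable section

namespace VOWA

/-! ### Calculus of locally finite sums of operators. -/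

section LocalSum

variable {K : Type*} [Field K] {V : Type*} [AddCommGroup V] [Module K V] {α β : Type*}
  {S T : α → Module.End K V}

/-! Everything is governed by two odd operators. With `k φ = ∑ φ(n) β_n c_{-n}` for arbitrary
coefficients `φ`, bracketing with `h` sends `β` to `b`, `c` to `γ` and kills `b`, `γ`, while
bracketing with `k φ` sends `b_n` to `φ(n) β_n`, `γ_{-n}` to `-φ(n) c_{-n}` and kills `β`, `c`.
Hence `weight φ = h k + k h` acts diagonally on the modes: its bracket with `β_n`, `b_n` multiplies
them by `φ(n)`, that with `γ_{-n}`, `c_{-n}` by `-φ(n)`. The normal-ordering corrections of the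
bosons and the fermions have opposite signs, so `L₀` is exactly `weight φ` for `φ(n) = -n`
(`localSum_vir`).

If the creation operators raise such a weight by nonnegative integers, the space splits as the
kernel plus the range of the weight operator (`isKernelSplit_of_raising`). For `L₀` the kernel is
`Wℓ`, because only `γ_0` and `c_0` have weight zero. For `φ = ±1` according to the sign of the
index, the weight counts the generators and the kernel is the line of the vacuum.

A differential that commutes with a split operator has as kernel of that operator on cohomology the
cohomology of the kernel (`range_cohomologyMap`); if the operator is moreover null-homotopic, its
kernel carries all the cohomology (`cohomologyMap_bijective`). Both weights are null-homotopic for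
`h`, so the cohomology of `h` is that of `Wℓ` and is also the line of the vacuum. `L₀` is
null-homotopic for `k`, with homotopy `-h`, and `k` vanishes on `Wℓ`. For `Q` only the commutation
with `L₀` is available, which gives the statement in degree zero.

Properties of `Q` come from a potential: `2Q = [h, R]`, where `R` is a sum of terms `β c c` with the
bracket of `ℓ` as coefficients (`localSum_q`; again the anomalies cancel). The Jacobi identity gives
`[Q, R] = 0` (`Q_R`), and `h² = 0` gives `hQ = -Qh`; so `Q` anticommutes with `[h, R]`, that is with
`2Q`, whence `Q² = 0`. The classical differentials are the restrictions of `Q` and `h` to `Wℓ`,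
where only zero modes act, and inherit their squares. -/

theorem localSum_apply (hT : IsLocallyFinite T) (w : V) : localSum T w = ∑ᶠ a, T a w := by
  unfold localSum
  rw [dif_pos hT]
  rfl

theorem IsLocallyFinite.mul_left (hT : IsLocallyFinite T) (A : Module.End K V) :
    IsLocallyFinite fun a => A * T a := fun w =>
  (hT w).subset fun a ha h => ha (by simp [h])

theorem IsLocallyFinite.mul_right (hT : IsLocallyFinite T) (A : Module.End K V) :
    IsLocallyFinite fun a => T a * A := fun w => hT (A w)

theorem IsLocallyFinite.add (hS : IsLocallyFinite S) (hT : IsLocallyFinite T) :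
    IsLocallyFinite fun a => S a + T a := fun w =>
  ((hS w).union (hT w)).subset fun a ha => by
    by_contra h
    simp only [Set.mem_union, Set.mem_ofPred_eq, not_or, not_not] at h
    exact ha (by simp [h.1, h.2])

theorem IsLocallyFinite.neg (hT : IsLocallyFinite T) : IsLocallyFinite fun a => -T a := fun w =>
  (hT w).subset fun a ha h => ha (by simp [h])

theorem IsLocallyFinite.sub (hS : IsLocallyFinite S) (hT : IsLocallyFinite T) :
    IsLocallyFinite fun a => S a - T a := by
  simpa only [sub_eq_add_neg] using hS.add hT.neg

theorem IsLocallyFinite.comp_injective (hT : IsLocallyFinite T) {e : β → α}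
    (he : Function.Injective e) : IsLocallyFinite fun b => T (e b) := fun w =>
  (hT w).preimage he.injOn

theorem localSum_zero : localSum (fun _ : α => (0 : Module.End K V)) = 0 := by
  ext w
  rw [localSum_apply (fun w => by simp)]
  simp

theorem localSum_add (hS : IsLocallyFinite S) (hT : IsLocallyFinite T) :
    localSum (fun a => S a + T a) = localSum S + localSum T := by
  ext w
  rw [localSum_apply (hS.add hT), LinearMap.add_apply, localSum_apply hS, localSum_apply hT]
  exact finsum_add_distrib (hS w) (hT w)

theorem localSum_neg (hT : IsLocallyFinite T) :
    localSum (fun a => -T a) = -localSum T := by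
  rw [eq_neg_iff_add_eq_zero, ← localSum_add hT.neg hT]
  simp only [neg_add_cancel, localSum_zero]

theorem localSum_sub (hS : IsLocallyFinite S) (hT : IsLocallyFinite T) :
    localSum (fun a => S a - T a) = localSum S - localSum T := by
  simp only [sub_eq_add_neg]
  rw [localSum_add hS hT.neg, localSum_neg hT]

theorem mul_localSum (hT : IsLocallyFinite T) (A : Module.End K V) :
    A * localSum T = localSum fun a => A * T a := by
  ext w
  rw [localSum_apply (hT.mul_left A), Module.End.mul_apply, localSum_apply hT]
  exact A.toAddMonoidHom.map_finsum (hT w)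

theorem localSum_mul (hT : IsLocallyFinite T) (A : Module.End K V) :
    localSum T * A = localSum fun a => T a * A := by
  ext w
  rw [localSum_apply (hT.mul_right A), Module.End.mul_apply, localSum_apply hT]
  rfl

theorem commutator_localSum (hT : IsLocallyFinite T) (A : Module.End K V) :
    A * localSum T - localSum T * A = localSum fun a => A * T a - T a * A := by
  rw [mul_localSum hT, localSum_mul hT, ← localSum_sub (hT.mul_left A) (hT.mul_right A)]

theorem anticommutator_localSum (hT : IsLocallyFinite T) (A : Module.End K V) :
    A * localSum T + localSum T * A = localSum fun a => A * T a + T a * A := by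
  rw [mul_localSum hT, localSum_mul hT, ← localSum_add (hT.mul_left A) (hT.mul_right A)]

theorem localSum_comp_equiv (hT : IsLocallyFinite T) (e : β ≃ α) :
    localSum (fun b => T (e b)) = localSum T := by
  ext w
  rw [localSum_apply (hT.comp_injective e.injective), localSum_apply hT]
  exact finsum_comp_equiv e (f := fun a => T a w)

theorem localSum_fin_support (s : Finset α) (hs : ∀ a ∉ s, T a = 0) :
    IsLocallyFinite T ∧ localSum T = ∑ a ∈ s, T a := by
  have hT : IsLocallyFinite T := fun w => s.finite_toSet.subset fun a ha => by
    by_contra h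
    exact ha (by simp [hs a h])
  refine ⟨hT, LinearMap.ext fun w => ?_⟩
  rw [localSum_apply hT, LinearMap.sum_apply]
  exact finsum_eq_sum_of_support_subset _ fun a ha => by
    by_contra h
    exact ha (by simp [hs a h])

theorem localSum_apply_eq_sum (hT : IsLocallyFinite T) (s : Finset α) (w : V)
    (hs : ∀ a ∉ s, T a w = 0) : localSum T w = ∑ a ∈ s, T a w := by
  rw [localSum_apply hT]
  exact finsum_eq_sum_of_support_subset _ fun a ha => by
    by_contra h
    exact ha (hs a h)

theorem IsLocallyFinite.fiber {F : α × β → Module.End K V} (hF : IsLocallyFinite F) (a : α) :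
    IsLocallyFinite fun b => F (a, b) :=
  hF.comp_injective (Prod.mk_right_injective a)

theorem IsLocallyFinite.localSum_fiber {F : α × β → Module.End K V} (hF : IsLocallyFinite F) :
    IsLocallyFinite fun a => localSum fun b => F (a, b) := fun w =>
  ((hF w).image Prod.fst).subset fun a ha => by
    by_contra h
    apply ha
    rw [localSum_apply (hF.fiber a)]
    refine finsum_eq_zero_of_forall_eq_zero fun b => ?_
    by_contra hb
    exact h ⟨(a, b), hb, rfl⟩

/-- Fubini. On a fixed vector only finitely many pairs contribute, so the inner and outer sums are
finite. The joint family must be assumed locally finite: convergence of the iterated sum alone would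
not permit the later exchanges of summation. -/
theorem localSum_prod {F : α × β → Module.End K V} (hF : IsLocallyFinite F) :
    localSum F = localSum fun a => localSum fun b => F (a, b) := by
  ext w
  rw [localSum_apply hF, localSum_apply hF.localSum_fiber, finsum_curry _ (hF w)]
  exact finsum_congr fun a => (localSum_apply (hF.fiber a) w).symm

end LocalSum

/-! ### Operators that split off their kernel, and their effect on cohomology. -/

section Cohomology

variable {K : Type*} [Field K] {U V W : Type*} [AddCommGroup U] [Module K U]
  [AddCommGroup V] [Module K V] [AddCommGroup W] [Module K W]

theorem Cohomology.mk_surjective {D : Module.End K V} (c : Cohomology D) :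
    ∃ (z : V) (hz : D z = 0), c = Cohomology.mk D z hz := by
  obtain ⟨⟨z, hz⟩, rfl⟩ := Submodule.Quotient.mk_surjective _ c
  exact ⟨z, hz, rfl⟩

theorem Cohomology.mk_eq_mk {D : Module.End K V} {y z : V} (hy : D y = 0) (hz : D z = 0) :
    Cohomology.mk D y hy = Cohomology.mk D z hz ↔ ∃ v, D v = y - z :=
  Submodule.Quotient.eq _

theorem cohomologyMap_mk {D : Module.End K V} {E : Module.End K W} (f : V →ₗ[K] W)
    (hf : E ∘ₗ f = f ∘ₗ D) (z : V) (hz : D z = 0) :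
    cohomologyMap f hf (Cohomology.mk D z hz) =
      Cohomology.mk E (f z) (by
        have := LinearMap.congr_fun hf z
        simp only [LinearMap.comp_apply] at this
        rw [this, hz, map_zero]) := rfl

theorem cohomologyMap_injective {D : Module.End K V} {E : Module.End K W} (f : V →ₗ[K] W)
    (hf : E ∘ₗ f = f ∘ₗ D) (h : ∀ a w, D a = 0 → E w = f a → ∃ b, D b = a) :
    Function.Injective (cohomologyMap f hf) := by
  rw [injective_iff_map_eq_zero]
  intro c hc
  obtain ⟨a, ha, rfl⟩ := Cohomology.mk_surjective c
  rw [cohomologyMap_mk] at hc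
  obtain ⟨w, hw⟩ := (Cohomology.mk_eq_mk _ (map_zero E)).1 hc
  obtain ⟨b, hb⟩ := h a w ha (by simpa using hw)
  exact (Cohomology.mk_eq_mk ha (map_zero D)).2 ⟨b, by simpa using hb⟩

theorem cohomologyMap_surjective {D : Module.End K V} {E : Module.End K W} (f : V →ₗ[K] W)
    (hf : E ∘ₗ f = f ∘ₗ D) (h : ∀ z, E z = 0 → ∃ a y, D a = 0 ∧ z = f a + E y) :
    Function.Surjective (cohomologyMap f hf) := by
  intro c
  obtain ⟨z, hz, rfl⟩ := Cohomology.mk_surjective c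
  obtain ⟨a, y, ha, rfl⟩ := h z hz
  refine ⟨Cohomology.mk D a ha, ?_⟩
  rw [cohomologyMap_mk, Cohomology.mk_eq_mk]
  exact ⟨-y, by simp⟩

theorem cohomologyMap_bijective_of_bijective {D : Module.End K V} {E : Module.End K W}
    (f : V →ₗ[K] W) (hf : E ∘ₗ f = f ∘ₗ D) (hb : Function.Bijective f) :
    Function.Bijective (cohomologyMap f hf) := by
  have hf' (v : V) : E (f v) = f (D v) := LinearMap.congr_fun hf v
  refine ⟨cohomologyMap_injective f hf fun a w _ hw => ?_,
    cohomologyMap_surjective f hf fun z hz => ?_⟩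
  · obtain ⟨b, rfl⟩ := hb.2 w
    exact ⟨b, hb.1 (by rw [← hf', hw])⟩
  · obtain ⟨a, rfl⟩ := hb.2 z
    exact ⟨a, 0, hb.1 (by rw [← hf', hz, map_zero]), by simp⟩

/-- The operator `L` is semisimple at `0` with kernel the image of the injection `i`. -/
structure IsKernelSplit (i : U →ₗ[K] W) (L : Module.End K W) : Prop where
  injective : Function.Injective i
  range_eq : LinearMap.range i = LinearMap.ker L
  isCompl : IsCompl (LinearMap.ker L) (LinearMap.range L)

namespace IsKernelSplit

variable {i : U →ₗ[K] W} {L : Module.End K W} (h : IsKernelSplit i L)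
include h

theorem apply_zero (a : U) : L (i a) = 0 := by
  have : i a ∈ LinearMap.ker L := h.range_eq ▸ LinearMap.mem_range_self i a
  exact this

theorem decompose (w : W) : ∃ a y, w = i a + L y := by
  obtain ⟨u, hu, v, ⟨y, rfl⟩, rfl⟩ := Submodule.mem_sup.1
    (h.isCompl.sup_eq_top ▸ Submodule.mem_top : w ∈ LinearMap.ker L ⊔ LinearMap.range L)
  rw [← h.range_eq] at hu
  obtain ⟨a, rfl⟩ := hu
  exact ⟨a, y, rfl⟩

/-- Splitting the range component once more costs nothing, since `L` kills the kernel part. The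
spare factor `L` is what the cohomological arguments consume. -/
theorem decompose_sq (w : W) : ∃ a y, w = i a + L (L y) := by
  obtain ⟨a, y, rfl⟩ := h.decompose w
  obtain ⟨b, z, rfl⟩ := h.decompose y
  exact ⟨a, z, by simp [h.apply_zero]⟩

theorem eq_zero_of_ker_range {w : W} (hw : L (L w) = 0) : L w = 0 := by
  have : L w ∈ LinearMap.ker L ⊓ LinearMap.range L := ⟨hw, w, rfl⟩
  rwa [h.isCompl.inf_eq_bot, Submodule.mem_bot] at this

theorem eq_zero_of_apply_eq {a : U} {w : W} (hw : i a = L w) : a = 0 ∧ L w = 0 := by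
  have h0 := h.eq_zero_of_ker_range (w := w) (by rw [← hw, h.apply_zero])
  exact ⟨h.injective (by rw [hw, h0, map_zero]), h0⟩

section

variable {D : Module.End K W} {d : Module.End K U} (hd : D ∘ₗ i = i ∘ₗ d)
  (hDL : D ∘ₗ L = L ∘ₗ D)
include hDL

/-- A primitive in `W` of a class from `U` can be replaced by its component in the kernel of `L`:
`D` respects the direct sum, so the range component contributes nothing. -/
theorem cohomologyMap_injective : Function.Injective (cohomologyMap i hd) := by
  have hd' (v : U) : D (i v) = i (d v) := LinearMap.congr_fun hd v
  have hDL' (v : W) : D (L v) = L (D v) := LinearMap.congr_fun hDL v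
  refine VOWA.cohomologyMap_injective i hd fun a w _ hw => ?_
  obtain ⟨b, y, rfl⟩ := h.decompose w
  have := (h.eq_zero_of_apply_eq (a := a - d b) (w := D y) (by
    rw [map_sub, ← hw, map_add, hd', hDL']; abel)).1
  exact ⟨b, (sub_eq_zero.1 this).symm⟩

/-- The cohomology of `D` on the kernel of `L` is the kernel of `L` on the cohomology of `D`. -/
theorem range_cohomologyMap : LinearMap.range (cohomologyMap i hd) =
    LinearMap.ker (cohomologyMap L hDL) := by
  have hd' (v : U) : D (i v) = i (d v) := LinearMap.congr_fun hd v
  have hDL' (v : W) : D (L v) = L (D v) := LinearMap.congr_fun hDL v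
  apply le_antisymm
  · rintro _ ⟨c, rfl⟩
    obtain ⟨a, ha, rfl⟩ := Cohomology.mk_surjective c
    rw [LinearMap.mem_ker, cohomologyMap_mk, cohomologyMap_mk]
    exact (Cohomology.mk_eq_mk _ (map_zero D)).2 ⟨0, by simp [h.apply_zero]⟩
  · intro c hc
    obtain ⟨z, hz, rfl⟩ := Cohomology.mk_surjective c
    rw [LinearMap.mem_ker, cohomologyMap_mk] at hc
    obtain ⟨y, hy⟩ := (Cohomology.mk_eq_mk _ (map_zero D)).1 hc
    rw [sub_zero] at hy
    obtain ⟨a, e, rfl⟩ := h.decompose z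
    -- The hypothesis now reads `i (d b) + L (L (D y)) = L (L e)`. Directness of the sum and
    -- semisimplicity at `0` remove one `L` at a time, leaving `L e = D (L y)`: the range component
    -- of the cocycle is exact.
    obtain ⟨b, y, rfl⟩ := h.decompose_sq y
    simp only [map_add, hd', hDL', h.apply_zero, zero_add] at hy hz
    have h1 := (h.eq_zero_of_apply_eq (a := d b) (w := L e - L (D y)) (by
      rw [map_sub, ← hy]; abel)).2
    have h2 : L (e - D y) = 0 := h.eq_zero_of_ker_range (by rwa [map_sub])
    rw [map_sub, sub_eq_zero] at h2
    have h3 := (h.eq_zero_of_apply_eq (a := d a) (w := -D e) (by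
      rw [map_neg, eq_neg_iff_add_eq_zero, hz])).1
    refine ⟨Cohomology.mk d a h3, ?_⟩
    rw [cohomologyMap_mk, Cohomology.mk_eq_mk]
    exact ⟨-(L y), by rw [map_neg, hDL', h2]; abel⟩

end

/-- If `L` is null-homotopic, the kernel of `L` carries all the cohomology. -/
theorem cohomologyMap_bijective {D s : Module.End K W} {d : Module.End K U}
    (hd : D ∘ₗ i = i ∘ₗ d) (hD : D * D = 0) (hs : D * s + s * D = L) :
    Function.Bijective (cohomologyMap i hd) := by
  have hDL : D ∘ₗ L = L ∘ₗ D := by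
    change D * L = L * D
    rw [← hs, mul_add, add_mul, ← mul_assoc, hD, mul_assoc s, hD, zero_mul, mul_zero, zero_add,
      add_zero, mul_assoc]
  have hd' (v : U) : D (i v) = i (d v) := LinearMap.congr_fun hd v
  have hDL' (v : W) : D (L v) = L (D v) := LinearMap.congr_fun hDL v
  refine ⟨h.cohomologyMap_injective hd hDL, cohomologyMap_surjective i hd fun z hz => ?_⟩
  -- With a single `L` the homotopy formula would leave the term `s (D y)`. With two, the cocycle
  -- condition forces `D (L y) = 0`, and `s (L y)` is a primitive of `L (L y)`.
  obtain ⟨a, y, rfl⟩ := h.decompose_sq z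
  rw [map_add, hd', hDL', hDL'] at hz
  have ha := (h.eq_zero_of_apply_eq (a := d a) (w := -L (D y)) (by
    rw [map_neg, eq_neg_iff_add_eq_zero, hz])).1
  rw [ha, map_zero, zero_add] at hz
  refine ⟨a, s (L y), ha, ?_⟩
  have h1 := LinearMap.congr_fun hs (L y)
  simp only [LinearMap.add_apply, Module.End.mul_apply] at h1
  rw [hDL', h.eq_zero_of_ker_range hz, map_zero, add_zero] at h1
  rw [h1]

end IsKernelSplit

/-- An operator is semisimple at `0` if raising operators of nonnegative weights generate the
space from its kernel. -/
theorem isKernelSplit_of_raising [CharZero K] {i : U →ₗ[K] W} {L : Module.End K W}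
    (hi : Function.Injective i) (hLi : ∀ a, L (i a) = 0) (A : Set (Module.End K W))
    (hA : ∀ T ∈ A, ∃ n : ℕ, L * T - T * L = (n : K) • T ∧
      (n = 0 → ∀ a, T (i a) ∈ LinearMap.range i))
    (hcyc : ∀ p : Submodule K W, LinearMap.range i ≤ p → (∀ T ∈ A, ∀ w ∈ p, T w ∈ p) → p = ⊤) :
    IsKernelSplit i L := by
  -- The sum of the eigenspaces for `1, 2, 3, …`. In characteristic zero these eigenvalues are
  -- invertible, so `E` lies in the range of `L` and meets the kernel only in `0`.
  set E : Submodule K W := ⨆ n : ℕ, L.eigenspace ((n : K) + 1) with hE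
  have hEL : E ≤ LinearMap.range L := iSup_le fun n w hw => by
    rw [Module.End.mem_eigenspace_iff] at hw
    exact ⟨((n : K) + 1)⁻¹ • w, by rw [map_smul, hw, smul_smul, inv_mul_cancel₀, one_smul]
                                   exact Nat.cast_add_one_ne_zero n⟩
  have htop : LinearMap.range i ⊔ E = ⊤ := by
    -- A raising operator maps an eigenvector for `m + 1` to one for `m + n + 1`, and the kernel to
    -- eigenvalue `n`. Only weight zero could leave the sum, and there the operator preserves the
    -- image of `i` by assumption.
    refine hcyc _ le_sup_left fun T hT w hw => ?_
    obtain ⟨n, hn, hn0⟩ := hA T hT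
    have hn' (v : W) : L (T v) = T (L v) + (n : K) • T v := by
      have := LinearMap.congr_fun hn v
      simp only [LinearMap.sub_apply, Module.End.mul_apply, LinearMap.smul_apply] at this
      rw [← this]; abel
    suffices LinearMap.range i ⊔ E ≤ (LinearMap.range i ⊔ E).comap T from this hw
    refine sup_le ?_ (iSup_le fun m w hw => ?_)
    · rintro _ ⟨a, rfl⟩
      rcases n with _ | n
      · exact Submodule.mem_sup_left (hn0 rfl a)
      · refine Submodule.mem_sup_right (Submodule.mem_iSup_of_mem n ?_)
        rw [Module.End.mem_eigenspace_iff, hn', hLi, map_zero, zero_add]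
        push_cast
        rfl
    · rw [Module.End.mem_eigenspace_iff] at hw
      refine Submodule.mem_sup_right (Submodule.mem_iSup_of_mem (m + n) ?_)
      rw [Module.End.mem_eigenspace_iff, hn', hw, map_smul, ← add_smul]
      push_cast
      congr 1
      ring
  have hdisj : Disjoint (LinearMap.ker L) E := by
    have := (Module.End.eigenspaces_iSupIndep L) 0
    rw [Module.End.eigenspace_zero] at this
    refine this.mono_right (iSup_le fun n => ?_)
    exact le_iSup₂_of_le ((n : K) + 1) (Nat.cast_add_one_ne_zero n) le_rfl
  have hdec (w : W) : ∃ a, ∃ e ∈ E, w = i a + e := by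
    obtain ⟨_, ⟨a, rfl⟩, e, he, rfl⟩ := Submodule.mem_sup.1
      (htop ▸ Submodule.mem_top : w ∈ LinearMap.range i ⊔ E)
    exact ⟨a, e, he, rfl⟩
  have hLE : LinearMap.range L ≤ E := by
    rintro _ ⟨w, rfl⟩
    obtain ⟨a, e, he, rfl⟩ := hdec w
    rw [map_add, hLi, zero_add]
    suffices E ≤ E.comap L from this he
    refine iSup_le fun n w hw => ?_
    have hw' := hw
    rw [Module.End.mem_eigenspace_iff] at hw'
    rw [Submodule.mem_comap, hw']
    exact Submodule.smul_mem _ _ (Submodule.mem_iSup_of_mem n hw)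
  have hrange : LinearMap.range i = LinearMap.ker L := by
    apply le_antisymm
    · rintro _ ⟨a, rfl⟩
      exact hLi a
    · intro w hw
      obtain ⟨a, e, he, rfl⟩ := hdec w
      have : e = 0 := by
        refine Submodule.disjoint_def.1 hdisj e ?_ he
        rwa [LinearMap.mem_ker, map_add, hLi, zero_add] at hw
      exact ⟨a, by rw [this, add_zero]⟩
  refine ⟨hi, hrange, hdisj.mono_right hLE, ?_⟩
  rw [codisjoint_iff, eq_top_iff, ← htop, ← hrange]
  exact sup_le_sup_left hEL _

end Cohomology

/-! ### Mode algebra: Koszul differential, homotopies and weights from the relations alone. -/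

/-- A smooth representation of the Weyl algebra of the `beta`, `gamma` and the Clifford algebra of
the `b`, `c`: every vector is killed by all modes of sufficiently large index. -/
structure ModeRep (K ℓ W : Type*) [Field K] [LieRing ℓ] [LieAlgebra K ℓ] [AddCommGroup W]
    [Module K W] where
  beta : ℤ → ℓ →ₗ[K] Module.End K W
  gamma : ℤ → Module.Dual K ℓ →ₗ[K] Module.End K W
  b : ℤ → ℓ →ₗ[K] Module.End K W
  c : ℤ → Module.Dual K ℓ →ₗ[K] Module.End K W
  gamma_beta : ∀ n m f x,
    gamma n f * beta m x = beta m x * gamma n f + (if m + n = 0 then f x else 0) • 1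
  beta_beta : ∀ m n x y, beta m x * beta n y = beta n y * beta m x
  gamma_gamma : ∀ m n f g, gamma m f * gamma n g = gamma n g * gamma m f
  c_b : ∀ n m f x, c n f * b m x = -(b m x * c n f) + (if m + n = 0 then f x else 0) • 1
  b_b : ∀ m n x y, b m x * b n y = -(b n y * b m x)
  c_c : ∀ m n f g, c m f * c n g = -(c n g * c m f)
  b_beta : ∀ m n x y, b m x * beta n y = beta n y * b m x
  b_gamma : ∀ m n x f, b m x * gamma n f = gamma n f * b m x
  c_beta : ∀ m n f x, c m f * beta n x = beta n x * c m f
  c_gamma : ∀ m n f g, c m f * gamma n g = gamma n g * c m f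
  bounded : ∀ w, ∃ N : ℤ, 1 ≤ N ∧ ∀ n, N ≤ n →
    (∀ x, beta n x w = 0) ∧ (∀ f, gamma n f w = 0) ∧ (∀ x, b n x w = 0) ∧ (∀ f, c n f w = 0)

namespace ModeRep

variable {K ℓ W : Type*} [Field K] [LieRing ℓ] [LieAlgebra K ℓ] [AddCommGroup W]
    [Module K W] (M : ModeRep K ℓ W)

/-- `w` is killed by all modes of index at least `N`. -/
def IsBounded (N : ℤ) (w : W) : Prop := 1 ≤ N ∧ ∀ n, N ≤ n →
    (∀ x, M.beta n x w = 0) ∧ (∀ f, M.gamma n f w = 0) ∧ (∀ x, M.b n x w = 0) ∧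
      (∀ f, M.c n f w = 0)

section Bounded

variable {M} {N : ℤ} {w : W} (h : M.IsBounded N w)
include h

theorem IsBounded.c_mul {n : ℤ} (hn : N ≤ n) (f g : Module.Dual K ℓ) (m : ℤ) :
    M.c n f (M.c m g w) = 0 := by
  rw [← Module.End.mul_apply, M.c_c, LinearMap.neg_apply, Module.End.mul_apply,
    (h.2 n hn).2.2.2, map_zero, neg_zero]

theorem IsBounded.c_mul_mul {n : ℤ} (hn : N ≤ n) (f g g' : Module.Dual K ℓ) (m m' : ℤ) :
    M.c n f (M.c m g (M.c m' g' w)) = 0 := by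
  rw [← Module.End.mul_apply, M.c_c, LinearMap.neg_apply, Module.End.mul_apply,
    h.c_mul hn, map_zero, neg_zero]

theorem IsBounded.beta_c_eq_zero {m n : ℤ} (hmn : N ≤ m ∨ N ≤ n) (x : ℓ)
    (f : Module.Dual K ℓ) : (M.beta m x * M.c n f) w = 0 := by
  rcases hmn with hm | hn
  · rw [← M.c_beta, Module.End.mul_apply, (h.2 m hm).1, map_zero]
  · rw [Module.End.mul_apply, (h.2 n hn).2.2.2, map_zero]

theorem IsBounded.gamma_b_eq_zero {m n : ℤ} (hmn : N ≤ m ∨ N ≤ n) (x : ℓ)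
    (f : Module.Dual K ℓ) : (M.gamma m f * M.b n x) w = 0 := by
  rcases hmn with hm | hn
  · rw [← M.b_gamma, Module.End.mul_apply, (h.2 m hm).2.1, map_zero]
  · rw [Module.End.mul_apply, (h.2 n hn).2.2.1, map_zero]

theorem IsBounded.beta_c_c_eq_zero {m n p : ℤ} (hmn : N ≤ m ∨ N ≤ n ∨ N ≤ p) (x : ℓ)
    (f g : Module.Dual K ℓ) : (M.beta m x * M.c n f * M.c p g) w = 0 := by
  rcases hmn with hm | hn | hp
  · rw [← M.c_beta, mul_assoc, ← M.c_beta, Module.End.mul_apply, Module.End.mul_apply,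
      (h.2 m hm).1, map_zero, map_zero]
  · rw [mul_assoc, Module.End.mul_apply, Module.End.mul_apply, h.c_mul hn, map_zero]
  · rw [Module.End.mul_apply, (h.2 p hp).2.2.2, map_zero]

theorem IsBounded.beta_c_c_c_eq_zero {m n p q : ℤ} (hmn : N ≤ m ∨ N ≤ n ∨ N ≤ p ∨ N ≤ q)
    (x : ℓ) (f g g' : Module.Dual K ℓ) :
    (M.beta m x * M.c n f * M.c p g * M.c q g') w = 0 := by
  rcases hmn with hm | hn | hp | hq
  · rw [← M.c_beta, mul_assoc _ (M.beta m x), ← M.c_beta, mul_assoc, mul_assoc _ (M.beta m x),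
      ← M.c_beta]
    simp only [Module.End.mul_apply, (h.2 m hm).1, map_zero]
  · simp only [Module.End.mul_apply, h.c_mul_mul hn, map_zero]
  · simp only [Module.End.mul_apply, h.c_mul hp, map_zero]
  · simp only [Module.End.mul_apply, (h.2 q hq).2.2.2, map_zero]

end Bounded

theorem exists_isBounded (w : W) : ∃ N, M.IsBounded N w := M.bounded w

section Box

variable {ι : Type*} [Fintype ι]

theorem finite_box (N : ℤ) : {a : ι × ℤ | -N ≤ a.2 ∧ a.2 ≤ N}.Finite :=
  (Set.finite_univ.prod (Set.finite_Icc (-N) N)).subset fun _ ha =>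
    ⟨Set.mem_univ _, ha.1, ha.2⟩

end Box

variable {ι : Type*} (B : Module.Basis ι K ℓ)

/-- The terms of `h`. -/
def hFamily (a : ι × ℤ) : Module.End K W := M.gamma (-a.2) (B.coord a.1) * M.b a.2 (B a.1)

/-- The terms of the homotopy operators with coefficients `φ`. -/
def kFamily (φ : ℤ → K) (a : ι × ℤ) : Module.End K W :=
  φ a.2 • (M.beta a.2 (B a.1) * M.c (-a.2) (B.coord a.1))

/-- The Koszul differential `h`. -/
def h : Module.End K W := localSum (M.hFamily B)

/-- The operator `∑ φ(n) β_n c_{-n}`. -/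
def k (φ : ℤ → K) : Module.End K W := localSum (M.kFamily B φ)

/-- The coefficient of the basis element `a` in the loop `x t^n`. -/
def delta (x : ℓ) (n : ℤ) (a : ι × ℤ) : K := if a.2 = n then B.coord a.1 x else 0

/-- The fermionic creation and annihilation operators dual to the basis of the loop algebra. -/
abbrev cc (a : ι × ℤ) : Module.End K W := M.c (-a.2) (B.coord a.1)

/-- The bosonic operator dual to `cc`. -/
abbrev gg (a : ι × ℤ) : Module.End K W := M.gamma (-a.2) (B.coord a.1)

/-- The bracket of basis elements of the loop algebra, as a bosonic operator. -/
abbrev betaBracket (a a' : ι × ℤ) : Module.End K W := M.beta (a.2 + a'.2) ⁅B a.1, B a'.1⁆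

/-- The terms of the potential `R` of `Q`. -/
def rFamily (p : (ι × ℤ) × (ι × ℤ)) : Module.End K W :=
  M.betaBracket B p.2 p.1 * M.cc B p.1 * M.cc B p.2

/-- Twice the potential `R` of `Q`. -/
def R : Module.End K W := localSum (M.rFamily B)

/-- Twice the differential `Q`. -/
def Q : Module.End K W := M.h B * M.R B - M.R B * M.h B

theorem cc_mul_b (a : ι × ℤ) (n : ℤ) (x : ℓ) :
    M.cc B a * M.b n x = -(M.b n x * M.cc B a) + delta B x n a • 1 := by
  rw [M.c_b, delta]
  simp only [add_neg_eq_zero, eq_comm (a := n)]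

theorem gg_mul_beta (a : ι × ℤ) (n : ℤ) (x : ℓ) :
    M.gg B a * M.beta n x = M.beta n x * M.gg B a + delta B x n a • 1 := by
  rw [M.gamma_beta, delta]
  simp only [add_neg_eq_zero, eq_comm (a := n)]

/-- The terms of the anticommutator of `Q` with `c`. -/
def gFamily (a : ι × ℤ) (p : (ι × ℤ) × (ι × ℤ)) : Module.End K W :=
  delta B ⁅B p.2.1, B p.1.1⁆ (p.2.2 + p.1.2) a • (M.cc B p.1 * M.cc B p.2)

/-- The `c`'s commute with `γ`, so the only contraction is that of `γ` with the factor `β`. -/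
theorem gg_R_term (a : ι × ℤ) (p : (ι × ℤ) × (ι × ℤ)) :
    M.gg B a * M.rFamily B p - M.rFamily B p * M.gg B a = M.gFamily B a p := by
  have hc (a' : ι × ℤ) : Commute (M.cc B a') (M.gg B a) := M.c_gamma _ _ _ _
  rw [rFamily, gFamily, mul_assoc (M.betaBracket B p.2 p.1), mul_assoc _ _ (M.gg B a),
    ((hc p.1).mul_left (hc p.2)).eq, ← mul_assoc, gg_mul_beta, add_mul, smul_mul_assoc, one_mul,
    mul_assoc (M.betaBracket B p.2 p.1), add_sub_cancel_left]

section Fintype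

variable [Fintype ι]

theorem isLocallyFinite_hFamily : IsLocallyFinite (M.hFamily B) := fun w => by
  obtain ⟨N, hN⟩ := M.exists_isBounded w
  refine (finite_box N).subset fun a ha => ?_
  by_contra hb
  exact ha (hN.gamma_b_eq_zero (by simp only [Set.mem_ofPred_eq] at hb; omega) _ _)

theorem isLocallyFinite_kFamily (φ : ℤ → K) : IsLocallyFinite (M.kFamily B φ) := fun w => by
  obtain ⟨N, hN⟩ := M.exists_isBounded w
  refine (finite_box N).subset fun a ha => ?_
  by_contra hb
  refine ha ?_
  rw [kFamily, LinearMap.smul_apply,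
    hN.beta_c_eq_zero (by simp only [Set.mem_ofPred_eq] at hb; omega), smul_zero]

/-- The three mode indices of a term sum to zero. If all are below `N`, each is therefore also
bounded below, which leaves a finite box. The same argument, with other box sizes, proves every
later local finiteness. -/
theorem isLocallyFinite_rFamily : IsLocallyFinite (M.rFamily B) := fun w => by
  obtain ⟨N, hN⟩ := M.exists_isBounded w
  refine ((finite_box (2 * N)).prod (finite_box (2 * N))).subset fun a ha => ?_
  by_contra hb
  refine ha (hN.beta_c_c_eq_zero ?_ _ _ _)
  simp only [Set.mem_prod, Set.mem_ofPred_eq] at hb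
  have := hN.1
  omega

/-- Basis expansion of the loop `x t^n`. It turns the contraction of a quadratic sum with one mode
back into one mode, for an arbitrary linear recipe `F`. -/
theorem localSum_delta (x : ℓ) (n : ℤ) (F : ℤ → ℓ →ₗ[K] Module.End K W) :
    localSum (fun a : ι × ℤ => delta B x n a • F a.2 (B a.1)) = F n x := by
  have := localSum_fin_support (T := fun a : ι × ℤ => delta B x n a • F a.2 (B a.1))
    (Finset.univ ×ˢ {n}) fun a ha => by
      rw [delta, if_neg fun h => ha (Finset.mem_product.2
        ⟨Finset.mem_univ _, Finset.mem_singleton.2 h⟩), zero_smul]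
  rw [this.2, Finset.sum_product]
  conv_rhs => rw [← B.sum_repr x, map_sum]
  refine Finset.sum_congr rfl fun u _ => ?_
  simp [delta]

theorem localSum_delta_dual (f : Module.Dual K ℓ) (n : ℤ)
    (F : ℤ → Module.Dual K ℓ →ₗ[K] Module.End K W) :
    localSum (fun a : ι × ℤ => (if a.2 + n = 0 then f (B a.1) else 0) • F (-a.2) (B.coord a.1)) =
      F n f := by
  have := localSum_fin_support (T := fun a : ι × ℤ =>
      (if a.2 + n = 0 then f (B a.1) else 0) • F (-a.2) (B.coord a.1))
    (Finset.univ ×ˢ {-n}) fun a ha => by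
      rw [if_neg fun h => ha (Finset.mem_product.2
        ⟨Finset.mem_univ _, Finset.mem_singleton.2 (eq_neg_of_add_eq_zero_left h)⟩), zero_smul]
  rw [this.2, Finset.sum_product]
  conv_rhs => rw [← B.sum_dual_apply_smul_coord f, map_sum]
  refine Finset.sum_congr rfl fun u _ => ?_
  simp

/-! ### Commutators with the modes -/

/-- Only the factor `γ` of `h` contracts with `β`. Together with the next three lemmas this says
that `h` is the superderivation `β ↦ b`, `c ↦ γ`, `b, γ ↦ 0` of the mode algebra. -/
theorem h_beta (n : ℤ) (x : ℓ) : M.h B * M.beta n x = M.beta n x * M.h B + M.b n x := by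
  rw [← sub_eq_iff_eq_add', ← neg_sub, h, commutator_localSum (M.isLocallyFinite_hFamily B),
    ← localSum_neg ((M.isLocallyFinite_hFamily B).mul_left _ |>.sub
      ((M.isLocallyFinite_hFamily B).mul_right _)), ← localSum_delta B x n M.b]
  congr 1
  ext1 a
  rw [hFamily, mul_assoc, M.b_beta, ← mul_assoc, ← mul_assoc, gg_mul_beta, add_mul,
    smul_mul_assoc, one_mul]
  abel

theorem h_c (n : ℤ) (f : Module.Dual K ℓ) :
    M.h B * M.c n f = -(M.c n f * M.h B) + M.gamma n f := by
  rw [← sub_eq_iff_eq_add', sub_neg_eq_add, add_comm, h,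
    anticommutator_localSum (M.isLocallyFinite_hFamily B), ← localSum_delta_dual B f n M.gamma]
  congr 1
  ext1 a
  rw [hFamily, ← mul_assoc, M.c_gamma, mul_assoc, M.c_b, mul_assoc, mul_add, mul_smul_comm,
    mul_one, mul_neg]
  abel

theorem h_b (n : ℤ) (x : ℓ) : M.h B * M.b n x = -(M.b n x * M.h B) := by
  rw [← add_eq_zero_iff_eq_neg, add_comm, h,
    anticommutator_localSum (M.isLocallyFinite_hFamily B), ← localSum_zero (α := ι × ℤ)]
  congr 1
  ext1 a
  rw [hFamily, ← mul_assoc, M.b_gamma, mul_assoc, M.b_b, mul_assoc, mul_neg, neg_add_cancel]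

theorem h_gamma (n : ℤ) (f : Module.Dual K ℓ) : M.h B * M.gamma n f = M.gamma n f * M.h B := by
  rw [eq_comm, ← sub_eq_zero, h,
    commutator_localSum (M.isLocallyFinite_hFamily B), ← localSum_zero (α := ι × ℤ)]
  congr 1
  ext1 a
  rw [hFamily, ← mul_assoc, M.gamma_gamma, mul_assoc, ← M.b_gamma, mul_assoc, sub_self]

theorem k_beta (φ : ℤ → K) (n : ℤ) (x : ℓ) :
    M.k B φ * M.beta n x = M.beta n x * M.k B φ := by
  rw [eq_comm, ← sub_eq_zero, k,
    commutator_localSum (M.isLocallyFinite_kFamily B φ), ← localSum_zero (α := ι × ℤ)]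
  congr 1
  ext1 a
  rw [kFamily, mul_smul_comm, smul_mul_assoc, ← mul_assoc, M.beta_beta, mul_assoc, ← M.c_beta,
    mul_assoc, sub_self]

theorem k_c (φ : ℤ → K) (n : ℤ) (f : Module.Dual K ℓ) :
    M.k B φ * M.c n f = -(M.c n f * M.k B φ) := by
  rw [← add_eq_zero_iff_eq_neg, add_comm, k,
    anticommutator_localSum (M.isLocallyFinite_kFamily B φ), ← localSum_zero (α := ι × ℤ)]
  congr 1
  ext1 a
  rw [kFamily, mul_smul_comm, smul_mul_assoc, ← mul_assoc, M.c_beta, mul_assoc, M.c_c, mul_assoc,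
    mul_neg, smul_neg, neg_add_cancel]

/-- Only the factor `c` of `k` contracts with `b`. The coefficient `φ n` goes inside the linear
recipe of `localSum_delta`, since it depends on the summation index. -/
theorem k_b (φ : ℤ → K) (n : ℤ) (x : ℓ) :
    M.k B φ * M.b n x = -(M.b n x * M.k B φ) + φ n • M.beta n x := by
  rw [← sub_eq_iff_eq_add', sub_neg_eq_add, add_comm, k,
    anticommutator_localSum (M.isLocallyFinite_kFamily B φ)]
  have := localSum_delta B x n (fun n => φ n • M.beta n)
  simp only [LinearMap.smul_apply] at this
  rw [← this]
  congr 1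
  ext1 a
  rw [kFamily, mul_smul_comm, smul_mul_assoc, ← mul_assoc, M.b_beta, mul_assoc, mul_assoc,
    cc_mul_b, mul_add, mul_smul_comm, mul_one, mul_neg, smul_add, smul_neg, smul_comm]
  abel

theorem k_gamma (φ : ℤ → K) (n : ℤ) (f : Module.Dual K ℓ) :
    M.k B φ * M.gamma n f = M.gamma n f * M.k B φ - φ (-n) • M.c n f := by
  rw [eq_comm, sub_eq_iff_eq_add, ← sub_eq_iff_eq_add', k,
    commutator_localSum (M.isLocallyFinite_kFamily B φ)]
  have := localSum_delta_dual B f n (fun n => φ (-n) • M.c n)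
  simp only [LinearMap.smul_apply, neg_neg] at this
  rw [← this]
  congr 1
  ext1 a
  rw [kFamily, mul_smul_comm, smul_mul_assoc, ← mul_assoc, M.gamma_beta, mul_assoc (M.beta _ _),
    M.c_gamma, add_mul, ← mul_assoc, smul_mul_assoc, one_mul, smul_add, smul_comm]
  abel

/-- `h` anticommutes with each of its own terms, so `2h² = 0`. -/
theorem h_sq [CharZero K] : M.h B * M.h B = 0 := by
  have h2 : M.h B * M.h B + M.h B * M.h B = 0 := by
    refine (anticommutator_localSum (M.isLocallyFinite_hFamily B) _).trans ?_
    rw [← localSum_zero (α := ι × ℤ)]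
    congr 1
    ext1 a
    rw [hFamily, ← mul_assoc, h_gamma, mul_assoc, h_b, mul_assoc, mul_neg, neg_add_cancel]
  rw [← two_smul K, smul_eq_zero] at h2
  exact h2.resolve_left two_ne_zero

theorem k_sq [CharZero K] (φ : ℤ → K) : M.k B φ * M.k B φ = 0 := by
  have h2 : M.k B φ * M.k B φ + M.k B φ * M.k B φ = 0 := by
    refine (anticommutator_localSum (M.isLocallyFinite_kFamily B φ) _).trans ?_
    rw [← localSum_zero (α := ι × ℤ)]
    congr 1
    ext1 a
    rw [kFamily, mul_smul_comm, ← mul_assoc, k_beta, mul_assoc, k_c, smul_mul_assoc, mul_assoc,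
      mul_neg, smul_neg, neg_add_cancel]
  rw [← two_smul K, smul_eq_zero] at h2
  exact h2.resolve_left two_ne_zero

/-- The weight operator with weights `φ(n)` on `β_n`, `b_n` and `-φ(n)` on `γ_{-n}`, `c_{-n}`. -/
def weight (φ : ℤ → K) : Module.End K W := M.h B * M.k B φ + M.k B φ * M.h B

/-- The anticommutator of two odd superderivations is an even derivation; here it sends `β` to `b`
by `h` and back to `φ(n) β` by `k`. The same round trip gives the other three modes. -/
theorem weight_beta (φ : ℤ → K) (n : ℤ) (x : ℓ) :
    M.weight B φ * M.beta n x = M.beta n x * M.weight B φ + φ n • M.beta n x := by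
  rw [weight, add_mul, mul_assoc, k_beta, ← mul_assoc, h_beta, mul_assoc, h_beta, mul_add, k_b,
    ← mul_assoc, k_beta]
  noncomm_ring

theorem weight_b (φ : ℤ → K) (n : ℤ) (x : ℓ) :
    M.weight B φ * M.b n x = M.b n x * M.weight B φ + φ n • M.b n x := by
  rw [weight, add_mul, mul_assoc, k_b, mul_assoc, h_b, mul_add, mul_smul_comm, h_beta, mul_neg,
    mul_neg, ← mul_assoc, ← mul_assoc, h_b, k_b, add_mul, smul_mul_assoc, smul_add]
  noncomm_ring

theorem weight_c (φ : ℤ → K) (n : ℤ) (f : Module.Dual K ℓ) :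
    M.weight B φ * M.c n f = M.c n f * M.weight B φ - φ (-n) • M.c n f := by
  rw [weight, add_mul, mul_assoc, k_c, mul_neg, ← mul_assoc, h_c, mul_assoc, h_c, mul_add, k_gamma,
    mul_neg, ← mul_assoc, k_c]
  noncomm_ring

theorem weight_gamma (φ : ℤ → K) (n : ℤ) (f : Module.Dual K ℓ) :
    M.weight B φ * M.gamma n f = M.gamma n f * M.weight B φ - φ (-n) • M.gamma n f := by
  rw [weight, add_mul, mul_assoc, k_gamma, mul_assoc, h_gamma, mul_sub, mul_smul_comm, h_c,
    ← mul_assoc, ← mul_assoc, h_gamma, k_gamma, sub_mul, smul_mul_assoc, smul_add,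
    smul_neg]
  simp only [mul_assoc, mul_add]
  abel

theorem weight_h [CharZero K] (φ : ℤ → K) : M.weight B φ * M.h B = M.h B * M.weight B φ := by
  rw [weight, add_mul, mul_add, mul_assoc (M.k B φ), h_sq, ← mul_assoc (M.h B) (M.h B), h_sq,
    mul_assoc]
  simp

/-! ### The differential `Q` -/

/-- A term `β_{m+n} c_{-m} c_{-n}` has weight `φ(m+n) - φ(m) - φ(n)`, which additivity makes zero.
-/
theorem weight_R (φ : ℤ → K) (hφ : ∀ m n, φ (m + n) = φ m + φ n) :
    M.weight B φ * M.R B = M.R B * M.weight B φ := by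
  rw [← sub_eq_zero, R, commutator_localSum (M.isLocallyFinite_rFamily B),
    ← localSum_zero (α := (ι × ℤ) × (ι × ℤ))]
  congr 1
  ext1 a
  rw [rFamily, ← mul_assoc, ← mul_assoc, weight_beta, hφ, add_mul, add_mul, mul_assoc (M.beta _ _),
    weight_c, mul_sub, ← mul_assoc, sub_mul, mul_assoc (_ * _) (M.weight B φ), weight_c]
  simp only [neg_neg, mul_sub, mul_smul_comm, smul_mul_assoc, mul_assoc, add_smul, add_mul]
  abel

theorem weight_Q [CharZero K] (φ : ℤ → K) (hφ : ∀ m n, φ (m + n) = φ m + φ n) :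
    M.weight B φ * M.Q B = M.Q B * M.weight B φ := by
  rw [Q, mul_sub, sub_mul, ← mul_assoc, weight_h, mul_assoc, weight_R _ _ _ hφ, ← mul_assoc,
    ← mul_assoc, weight_R _ _ _ hφ, mul_assoc (M.R B), weight_h, mul_assoc (M.R B)]

theorem h_Q [CharZero K] : M.h B * M.Q B = -(M.Q B * M.h B) := by
  rw [Q, mul_sub, sub_mul, ← mul_assoc, h_sq, mul_assoc (M.R B), h_sq]
  noncomm_ring

/-- The terms of the commutator of `Q` with `β_n^x`. -/
def sFamily (n : ℤ) (x : ℓ) (a : ι × ℤ) : Module.End K W :=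
  M.beta (a.2 + n) ⁅B a.1, x⁆ * M.cc B a

/-- The trilinear terms that cancel by the Jacobi identity. -/
def jFamily (p : ((ι × ℤ) × (ι × ℤ)) × (ι × ℤ)) : Module.End K W :=
  M.beta (p.2.2 + (p.1.2.2 + p.1.1.2)) ⁅B p.2.1, ⁅B p.1.2.1, B p.1.1.1⁆⁆ * M.cc B p.2 *
    M.cc B p.1.1 * M.cc B p.1.2

theorem isLocallyFinite_sFamily (n : ℤ) (x : ℓ) : IsLocallyFinite (M.sFamily B n x) := fun w => by
  obtain ⟨N, hN⟩ := M.exists_isBounded w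
  refine (finite_box (N + |n|)).subset fun a ha => ?_
  by_contra hb
  refine ha (hN.beta_c_eq_zero ?_ _ _)
  simp only [Set.mem_ofPred_eq] at hb
  have := hN.1
  have := neg_abs_le n
  have := abs_nonneg n
  omega

theorem isLocallyFinite_jFamily : IsLocallyFinite (M.jFamily B) := fun w => by
  obtain ⟨N, hN⟩ := M.exists_isBounded w
  refine (((finite_box (3 * N)).prod (finite_box (3 * N))).prod (finite_box (3 * N))).subset
    fun a ha => ?_
  by_contra hb
  refine ha (hN.beta_c_c_c_eq_zero ?_ _ _ _ _)
  simp only [Set.mem_prod, Set.mem_ofPred_eq] at hb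
  have := hN.1
  omega

theorem c_cyclic (m n p : ℤ) (f g f' : Module.Dual K ℓ) :
    M.c m f * (M.c n g * M.c p f') = M.c p f' * (M.c m f * M.c n g) := by
  rw [M.c_c n, mul_neg, ← mul_assoc, M.c_c m, neg_mul, neg_neg, mul_assoc]

/-- The product of three `c`'s is invariant under cyclic permutation, so averaging the sum over
cyclic reindexings leaves the Jacobi sum as coefficient. Hence three times the sum vanishes, and `3`
is invertible. -/
theorem localSum_jFamily [CharZero K] : localSum (M.jFamily B) = 0 := by
  let e : ((ι × ℤ) × (ι × ℤ)) × (ι × ℤ) ≃ ((ι × ℤ) × (ι × ℤ)) × (ι × ℤ) :=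
    { toFun := fun p => ((p.1.2, p.2), p.1.1)
      invFun := fun p => ((p.2, p.1.1), p.1.2)
      left_inv := fun p => rfl
      right_inv := fun p => rfl }
  have hJ := M.isLocallyFinite_jFamily B
  have h1 := localSum_comp_equiv hJ e
  have h2 := localSum_comp_equiv hJ (e.trans e)
  have h3 : localSum (M.jFamily B) + localSum (M.jFamily B) + localSum (M.jFamily B) = 0 := by
    have h4 : localSum (M.jFamily B) + localSum (M.jFamily B) + localSum (M.jFamily B) =
        localSum (M.jFamily B) + localSum (fun p => M.jFamily B (e p)) +
          localSum (fun p => M.jFamily B ((e.trans e) p)) := by rw [h1, h2]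
    rw [h4, ← localSum_add hJ (hJ.comp_injective e.injective),
      ← localSum_add (hJ.add (hJ.comp_injective e.injective))
        (hJ.comp_injective (e.trans e).injective),
      ← localSum_zero (α := ((ι × ℤ) × (ι × ℤ)) × (ι × ℤ))]
    congr 1
    ext1 p
    obtain ⟨⟨a, b⟩, x⟩ := p
    change M.beta (x.2 + (b.2 + a.2)) ⁅B x.1, ⁅B b.1, B a.1⁆⁆ * M.cc B x * M.cc B a * M.cc B b +
      M.beta (a.2 + (x.2 + b.2)) ⁅B a.1, ⁅B x.1, B b.1⁆⁆ * M.cc B a * M.cc B b * M.cc B x +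
      M.beta (b.2 + (a.2 + x.2)) ⁅B b.1, ⁅B a.1, B x.1⁆⁆ * M.cc B b * M.cc B x * M.cc B a = 0
    rw [show a.2 + (x.2 + b.2) = x.2 + (b.2 + a.2) by ring,
      show b.2 + (a.2 + x.2) = x.2 + (b.2 + a.2) by ring]
    simp only [mul_assoc]
    rw [M.c_cyclic (-a.2), M.c_cyclic (-b.2) (-x.2), M.c_cyclic (-a.2), ← M.c_cyclic (-a.2),
      M.c_cyclic (-a.2), ← add_mul, ← add_mul, ← map_add, ← map_add, add_right_comm,
      lie_jacobi, map_zero, zero_mul]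
  have h4 : (3 : K) • localSum (M.jFamily B) = 0 := by
    rw [← h3, show (3 : K) = 1 + 1 + 1 by norm_num, add_smul, add_smul, one_smul]
  exact (smul_eq_zero.1 h4).resolve_left three_ne_zero

theorem R_beta (n : ℤ) (x : ℓ) : M.R B * M.beta n x = M.beta n x * M.R B := by
  rw [eq_comm, ← sub_eq_zero, R,
    commutator_localSum (M.isLocallyFinite_rFamily B), ← localSum_zero (α := (ι × ℤ) × (ι × ℤ))]
  congr 1
  ext1 a
  have hc (a : ι × ℤ) : Commute (M.beta n x) (M.cc B a) := (M.c_beta _ _ _ _).symm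
  have hb : Commute (M.beta n x) (M.betaBracket B a.2 a.1) := M.beta_beta _ _ _ _
  exact sub_eq_zero.2 ((hb.mul_right (hc _)).mul_right (hc _))

theorem R_c (n : ℤ) (f : Module.Dual K ℓ) : M.R B * M.c n f = M.c n f * M.R B := by
  rw [eq_comm, ← sub_eq_zero, R,
    commutator_localSum (M.isLocallyFinite_rFamily B), ← localSum_zero (α := (ι × ℤ) × (ι × ℤ))]
  congr 1
  ext1 a
  have hc : Commute (M.c n f) (M.cc B a.1 * M.cc B a.2) := by
    rw [Commute, SemiconjBy, ← M.c_cyclic, mul_assoc]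
  have hb : Commute (M.c n f) (M.betaBracket B a.2 a.1) := M.c_beta _ _ _ _
  rw [rFamily, mul_assoc (M.betaBracket B a.2 a.1)]
  exact sub_eq_zero.2 (hb.mul_right hc)

/-- `b` contracts with either of the two `c`'s. Exchanging the summation indices and using the
antisymmetry of the bracket identifies the two contributions, hence the doubled right-hand side. -/
theorem b_R (n : ℤ) (x : ℓ) : M.b n x * M.R B - M.R B * M.b n x =
    localSum (M.sFamily B n x) + localSum (M.sFamily B n x) := by
  have hR := M.isLocallyFinite_rFamily B
  have hS := M.isLocallyFinite_sFamily B n x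
  let F : (ι × ℤ) × (ι × ℤ) → Module.End K W := fun p =>
    delta B x n p.2 • (M.betaBracket B p.1 p.2 * M.cc B p.1)
  have hF : IsLocallyFinite F := fun w => by
    obtain ⟨N, hN⟩ := M.exists_isBounded w
    refine ((finite_box (N + |n|)).prod (finite_box (N + |n|))).subset fun a ha => ?_
    by_contra hb
    refine ha ?_
    change (delta B x n a.2 • (M.betaBracket B a.1 a.2 * M.cc B a.1)) w = 0
    have h1 := hN.1
    have h2 := neg_abs_le n
    have h3 := le_abs_self n
    rw [delta]
    split_ifs with h
    · rw [LinearMap.smul_apply, hN.beta_c_eq_zero, smul_zero]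
      simp only [Set.mem_prod, Set.mem_ofPred_eq] at hb
      omega
    · rw [zero_smul, LinearMap.zero_apply]
  have hFS : localSum F = localSum (M.sFamily B n x) := by
    rw [localSum_prod hF]
    congr 1
    ext1 a
    exact localSum_delta B x n fun m => LinearMap.mulRight K (M.cc B a) ∘ₗ M.beta (a.2 + m) ∘ₗ
      (LieModule.toEnd K ℓ ℓ (B a.1))
  rw [R, commutator_localSum hR, ← hFS]
  nth_rw 1 [← localSum_comp_equiv hF (Equiv.prodComm _ _)]
  rw [← localSum_add (hF.comp_injective (Equiv.prodComm _ _).injective) hF]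
  congr 1
  ext1 p
  obtain ⟨a, a'⟩ := p
  change M.b n x * (M.betaBracket B a' a * M.cc B a * M.cc B a') -
    M.betaBracket B a' a * M.cc B a * M.cc B a' * M.b n x =
    delta B x n a • (M.betaBracket B a' a * M.cc B a') +
    delta B x n a' • (M.betaBracket B a a' * M.cc B a)
  have e : M.betaBracket B a a' = - M.betaBracket B a' a := by
    rw [betaBracket, ← lie_skew, map_neg, add_comm]
  rw [e, mul_assoc _ (M.cc B a') (M.b n x), cc_mul_b, mul_add, mul_neg,
    mul_assoc (M.betaBracket B a' a) (M.cc B a) (M.b n x * _), ← mul_assoc (M.cc B a) (M.b n x), cc_mul_b, ← mul_assoc, ← mul_assoc, M.b_beta]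
  simp only [mul_add, add_mul, mul_neg, neg_mul, mul_smul_comm, smul_mul_assoc, mul_one, one_mul,
    mul_assoc, smul_neg]
  abel

theorem isLocallyFinite_gFamily (a : ι × ℤ) : IsLocallyFinite (M.gFamily B a) := by
  have hR := M.isLocallyFinite_rFamily B
  have := (hR.mul_left (M.gg B a)).sub (hR.mul_right (M.gg B a))
  simpa only [gg_R_term] using this

theorem gg_R (a : ι × ℤ) :
    M.gg B a * M.R B - M.R B * M.gg B a = localSum (M.gFamily B a) := by
  rw [R, commutator_localSum (M.isLocallyFinite_rFamily B)]
  simp only [gg_R_term]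

/-- `R` contains only `β` and an even number of `c`, so it commutes with `β`; the Jacobi identity
for operators then reduces `[[h, R], β]` to `[b, R]`. -/
theorem Q_beta (n : ℤ) (x : ℓ) : M.Q B * M.beta n x = M.beta n x * M.Q B +
    (localSum (M.sFamily B n x) + localSum (M.sFamily B n x)) := by
  rw [← b_R, Q, sub_mul, mul_assoc, R_beta, mul_assoc, ← mul_assoc, h_beta, mul_add, ← mul_assoc,
    R_beta]
  noncomm_ring

/-- As for `β`: `R` commutes with `c`, and `h` turns `c` into `γ`, so only `[γ, R]` remains. -/
theorem Q_cc (a : ι × ℤ) : M.Q B * M.cc B a = -(M.cc B a * M.Q B) + localSum (M.gFamily B a) := by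
  rw [← gg_R, Q, sub_mul, mul_assoc, R_c, mul_assoc, ← mul_assoc, h_c, mul_add, mul_neg, ← mul_assoc,
    R_c]
  noncomm_ring

theorem localSum_beta_g_c : IsLocallyFinite (fun p : (ι × ℤ) × (ι × ℤ) =>
      M.betaBracket B p.2 p.1 * localSum (M.gFamily B p.1) * M.cc B p.2) ∧
    localSum (fun p : (ι × ℤ) × (ι × ℤ) =>
      M.betaBracket B p.2 p.1 * localSum (M.gFamily B p.1) * M.cc B p.2) =
    localSum (M.jFamily B) := by
  let F : ((ι × ℤ) × (ι × ℤ)) × ((ι × ℤ) × (ι × ℤ)) → Module.End K W := fun p =>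
    M.betaBracket B p.1.2 p.1.1 * M.gFamily B p.1.1 p.2 * M.cc B p.1.2
  have hF : IsLocallyFinite F := fun w => by
    obtain ⟨N, hN⟩ := M.exists_isBounded w
    refine (((finite_box (3 * N)).prod (finite_box (3 * N))).prod
      ((finite_box (3 * N)).prod (finite_box (3 * N)))).subset fun p hp => ?_
    by_contra hb
    refine hp ?_
    obtain ⟨⟨a, a'⟩, ⟨x, y⟩⟩ := p
    change (M.betaBracket B a' a * (delta B ⁅B y.1, B x.1⁆ (y.2 + x.2) a • (M.cc B x * M.cc B y)) *
      M.cc B a') w = 0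
    rw [delta]
    split_ifs with h
    · rw [mul_smul_comm, smul_mul_assoc, LinearMap.smul_apply, ← mul_assoc,
        hN.beta_c_c_c_eq_zero, smul_zero]
      simp only [Set.mem_prod, Set.mem_ofPred_eq] at hb
      have := hN.1
      omega
    · simp
  have hFsum : (fun p : (ι × ℤ) × (ι × ℤ) =>
      M.betaBracket B p.2 p.1 * localSum (M.gFamily B p.1) * M.cc B p.2) =
      fun p => localSum fun q => F (p, q) := by
    ext1 p
    have hg := M.isLocallyFinite_gFamily B p.1
    rw [mul_localSum hg, localSum_mul (hg.mul_left _)]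
  rw [hFsum]
  refine ⟨hF.localSum_fiber, ?_⟩
  -- Makes the index of the replaced factor `c` the innermost one, where the Kronecker delta
  -- collapses it and nests the two brackets.
  let e : (((ι × ℤ) × (ι × ℤ)) × (ι × ℤ)) × (ι × ℤ) ≃
      ((ι × ℤ) × (ι × ℤ)) × ((ι × ℤ) × (ι × ℤ)) :=
    { toFun := fun p => ((p.2, p.1.2), p.1.1)
      invFun := fun p => ((p.2, p.1.2), p.1.1)
      left_inv := fun p => rfl
      right_inv := fun p => rfl }
  rw [← localSum_prod hF, ← localSum_comp_equiv hF e, localSum_prod (hF.comp_injective e.injective)]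
  congr 1
  ext1 p
  obtain ⟨⟨x, y⟩, a'⟩ := p
  have := localSum_delta B ⁅B y.1, B x.1⁆ (y.2 + x.2) fun m =>
    LinearMap.mulRight K (M.cc B x * M.cc B y * M.cc B a') ∘ₗ M.beta (a'.2 + m) ∘ₗ
      (LieModule.toEnd K ℓ ℓ (B a'.1))
  refine Eq.trans ?_ (this.trans ?_)
  · congr 1
    ext1 a
    change M.betaBracket B a' a * (delta B ⁅B y.1, B x.1⁆ (y.2 + x.2) a • (M.cc B x * M.cc B y)) *
      M.cc B a' = delta B ⁅B y.1, B x.1⁆ (y.2 + x.2) a •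
        (M.betaBracket B a' a * (M.cc B x * M.cc B y * M.cc B a'))
    rw [mul_smul_comm, smul_mul_assoc]
    simp only [mul_assoc]
  · change M.beta (a'.2 + (y.2 + x.2)) ⁅B a'.1, ⁅B y.1, B x.1⁆⁆ *
      (M.cc B x * M.cc B y * M.cc B a') = M.beta (a'.2 + (y.2 + x.2)) ⁅B a'.1, ⁅B y.1, B x.1⁆⁆ *
      M.cc B a' * M.cc B x * M.cc B y
    simp only [mul_assoc]
    rw [M.c_cyclic]

theorem localSum_beta_c_g : IsLocallyFinite (fun p : (ι × ℤ) × (ι × ℤ) =>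
      M.betaBracket B p.2 p.1 * M.cc B p.1 * localSum (M.gFamily B p.2)) ∧
    localSum (fun p : (ι × ℤ) × (ι × ℤ) =>
      M.betaBracket B p.2 p.1 * M.cc B p.1 * localSum (M.gFamily B p.2)) =
    -localSum (M.jFamily B) := by
  -- Replacing the second `c` instead of the first amounts to exchanging the two indices: the
  -- quadratic `G` passes through `c`, and the bracket supplies the sign.
  have h := M.localSum_beta_g_c B
  have e : (fun p : (ι × ℤ) × (ι × ℤ) =>
      M.betaBracket B p.2 p.1 * M.cc B p.1 * localSum (M.gFamily B p.2)) = fun p =>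
      -(fun p : (ι × ℤ) × (ι × ℤ) =>
        M.betaBracket B p.2 p.1 * localSum (M.gFamily B p.1) * M.cc B p.2) (p.2, p.1) := by
    ext1 p
    have hg := M.isLocallyFinite_gFamily B p.2
    change _ = -(M.betaBracket B p.1 p.2 * localSum (M.gFamily B p.2) * M.cc B p.1)
    have e : M.betaBracket B p.1 p.2 = - M.betaBracket B p.2 p.1 := by
      rw [betaBracket, ← lie_skew, map_neg, add_comm]
    rw [e, neg_mul, neg_mul, neg_neg, mul_assoc, mul_assoc, mul_localSum hg, localSum_mul hg]
    congr 2
    ext1 q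
    rw [gFamily, mul_smul_comm, smul_mul_assoc, mul_assoc, ← M.c_cyclic]
  have hi := h.1.comp_injective (Equiv.prodComm (ι × ℤ) (ι × ℤ)).injective
  rw [e]
  refine ⟨hi.neg, ?_⟩
  rw [← h.2, ← localSum_comp_equiv h.1 (Equiv.prodComm (ι × ℤ) (ι × ℤ))]
  exact localSum_neg hi

theorem localSum_s_c_c : IsLocallyFinite (fun p : (ι × ℤ) × (ι × ℤ) =>
      localSum (M.sFamily B (p.2.2 + p.1.2) ⁅B p.2.1, B p.1.1⁆) * M.cc B p.1 * M.cc B p.2) ∧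
    localSum (fun p : (ι × ℤ) × (ι × ℤ) =>
      localSum (M.sFamily B (p.2.2 + p.1.2) ⁅B p.2.1, B p.1.1⁆) * M.cc B p.1 * M.cc B p.2) =
    localSum (M.jFamily B) := by
  have hJ := M.isLocallyFinite_jFamily B
  have e : (fun p : (ι × ℤ) × (ι × ℤ) =>
      localSum (M.sFamily B (p.2.2 + p.1.2) ⁅B p.2.1, B p.1.1⁆) * M.cc B p.1 * M.cc B p.2) =
      fun p => localSum fun x => M.jFamily B (p, x) := by
    ext1 p
    have hs := M.isLocallyFinite_sFamily B (p.2.2 + p.1.2) ⁅B p.2.1, B p.1.1⁆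
    rw [localSum_mul hs, localSum_mul (hs.mul_right _)]
    rfl
  rw [e]
  exact ⟨hJ.localSum_fiber, (localSum_prod hJ).symm⟩

/-- By the Leibniz rule `Q` acts on the three factors of `β c c` in turn. Each of the resulting sums
is a multiple of the cyclic Jacobi sum, which vanishes. -/
theorem Q_R [CharZero K] : M.Q B * M.R B = M.R B * M.Q B := by
  rw [← sub_eq_zero]
  have h1 := M.localSum_s_c_c B
  have h2 := M.localSum_beta_g_c B
  have h3 := M.localSum_beta_c_g B
  have hJ := M.localSum_jFamily B
  rw [hJ] at h1 h2 h3
  have : M.Q B * M.R B - M.R B * M.Q B = localSum (fun p : (ι × ℤ) × (ι × ℤ) =>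
      (localSum (M.sFamily B (p.2.2 + p.1.2) ⁅B p.2.1, B p.1.1⁆) * M.cc B p.1 * M.cc B p.2 +
      localSum (M.sFamily B (p.2.2 + p.1.2) ⁅B p.2.1, B p.1.1⁆) * M.cc B p.1 * M.cc B p.2) +
      M.betaBracket B p.2 p.1 * localSum (M.gFamily B p.1) * M.cc B p.2 -
      M.betaBracket B p.2 p.1 * M.cc B p.1 * localSum (M.gFamily B p.2)) := by
    rw [R, commutator_localSum (M.isLocallyFinite_rFamily B)]
    congr 1
    ext1 p
    rw [rFamily, ← mul_assoc, ← mul_assoc, Q_beta, add_mul, add_mul, mul_assoc (M.beta _ _),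
      Q_cc, mul_add, mul_neg, ← mul_assoc, add_mul, neg_mul, mul_assoc (_ * _) (M.Q B), Q_cc,
      mul_add]
    simp only [add_mul, mul_neg, mul_assoc]
    abel
  rw [this, localSum_sub ((h1.1.add h1.1).add h2.1) h3.1, localSum_add (h1.1.add h1.1) h2.1,
    localSum_add h1.1 h1.1, h1.2, h2.2, h3.2]
  simp

/-- `Q` commutes with `R` and anticommutes with `h`, so it anticommutes with `[h, R]`, which is `Q`
itself; hence `2Q² = 0`. -/
theorem Q_sq [CharZero K] : M.Q B * M.Q B = 0 := by
  have hQ : M.Q B * M.h B = -(M.h B * M.Q B) := by rw [h_Q, neg_neg]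
  have h1 : M.Q B * (M.h B * M.R B - M.R B * M.h B) =
      -((M.h B * M.R B - M.R B * M.h B) * M.Q B) := by
    rw [mul_sub, ← mul_assoc, ← mul_assoc, Q_R, hQ, mul_assoc (M.R B) (M.Q B), hQ, neg_mul,
      mul_assoc (M.h B) (M.Q B), Q_R]
    noncomm_ring
  change M.Q B * M.Q B = -(M.Q B * M.Q B) at h1
  rw [eq_neg_iff_add_eq_zero, ← two_smul K, smul_eq_zero] at h1
  exact h1.resolve_left two_ne_zero

/-! ### Normal ordering -/

/-- `:β_m^x γ_n^f:` -/
def normalBetaGamma (x : ℓ) (m : ℤ) (f : Module.Dual K ℓ) (n : ℤ) : Module.End K W :=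
  if 0 ≤ m then M.gamma n f * M.beta m x else M.beta m x * M.gamma n f

/-- `:b_m^x c_n^f:` -/
def normalBC (x : ℓ) (m : ℤ) (f : Module.Dual K ℓ) (n : ℤ) : Module.End K W :=
  if 0 ≤ m then -(M.c n f * M.b m x) else M.b m x * M.c n f

/-- `:b_m^x c_n^f c_p^g:` -/
def normalBCC (x : ℓ) (m : ℤ) (f : Module.Dual K ℓ) (n : ℤ) (g : Module.Dual K ℓ) (p : ℤ) :
    Module.End K W :=
  if 0 ≤ m then M.c n f * M.c p g * M.b m x else M.b m x * M.c n f * M.c p g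

section Bounded

variable {M} {N : ℤ} {w : W} (h : M.IsBounded N w)
include h

/-- For negative `m` the high index must be `n`, and `γ_n` already stands on the right. For `0 ≤ m <
N ≤ n` the bound `1 ≤ N` excludes `m + n = 0`, so `γ_n` may be moved to the right without a
contraction. -/
theorem IsBounded.normalBetaGamma_eq_zero {m n : ℤ} (hmn : N ≤ m ∨ N ≤ n) (x : ℓ)
    (f : Module.Dual K ℓ) : M.normalBetaGamma x m f n w = 0 := by
  have h1 := h.1
  rw [normalBetaGamma]
  split_ifs with hm
  · by_cases hm : N ≤ m
    · rw [Module.End.mul_apply, (h.2 m hm).1, map_zero]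
    · rw [M.gamma_beta, if_neg (by omega), zero_smul, add_zero, Module.End.mul_apply,
        (h.2 n (by omega)).2.1, map_zero]
  · rw [Module.End.mul_apply, (h.2 n (by omega)).2.1, map_zero]

theorem IsBounded.normalBC_eq_zero {m n : ℤ} (hmn : N ≤ m ∨ N ≤ n) (x : ℓ)
    (f : Module.Dual K ℓ) : M.normalBC x m f n w = 0 := by
  have h1 := h.1
  rw [normalBC]
  split_ifs with hm
  · by_cases hm : N ≤ m
    · rw [LinearMap.neg_apply, Module.End.mul_apply, (h.2 m hm).2.2.1, map_zero, neg_zero]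
    · rw [M.c_b, if_neg (by omega), zero_smul, add_zero, neg_neg, Module.End.mul_apply,
        (h.2 n (by omega)).2.2.2, map_zero]
  · rw [Module.End.mul_apply, (h.2 n (by omega)).2.2.2, map_zero]

theorem IsBounded.normalBetaGamma_c_eq_zero {m n p : ℤ} (hmn : N ≤ m ∨ N ≤ n ∨ N ≤ p) (x : ℓ)
    (f g : Module.Dual K ℓ) : (M.normalBetaGamma x m f n * M.c p g) w = 0 := by
  by_cases hp : N ≤ p
  · rw [Module.End.mul_apply, (h.2 p hp).2.2.2, map_zero]
  · have e : M.normalBetaGamma x m f n * M.c p g = M.c p g * M.normalBetaGamma x m f n := by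
      rw [normalBetaGamma]
      split_ifs
      · rw [mul_assoc, ← M.c_beta, ← mul_assoc, ← M.c_gamma, mul_assoc]
      · rw [mul_assoc, ← M.c_gamma, ← mul_assoc, ← M.c_beta, mul_assoc]
    rw [e, Module.End.mul_apply, h.normalBetaGamma_eq_zero (by omega), map_zero]

theorem IsBounded.normalBCC_eq_zero {m n p : ℤ} (hmn : N ≤ m ∨ N ≤ n ∨ N ≤ p) (x : ℓ)
    (f g : Module.Dual K ℓ) : M.normalBCC x m f n g p w = 0 := by
  have h1 := h.1
  have hcb {q : ℤ} (hq : N ≤ q) (hm : 0 ≤ m) (f : Module.Dual K ℓ) : M.c q f (M.b m x w) = 0 := by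
    rw [← Module.End.mul_apply, M.c_b, if_neg (by omega), zero_smul, add_zero,
      LinearMap.neg_apply, Module.End.mul_apply, (h.2 q hq).2.2.2, map_zero, neg_zero]
  rw [normalBCC]
  split_ifs with hm
  · rcases hmn with hm | hn | hp
    · rw [Module.End.mul_apply, (h.2 m hm).2.2.1, map_zero]
    · rw [M.c_c, neg_mul, LinearMap.neg_apply, mul_assoc, Module.End.mul_apply,
        Module.End.mul_apply, hcb hn hm, map_zero, neg_zero]
    · rw [mul_assoc, Module.End.mul_apply, Module.End.mul_apply, hcb hp hm, map_zero]
  · by_cases hp : N ≤ p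
    · rw [Module.End.mul_apply, (h.2 p hp).2.2.2, map_zero]
    · rw [mul_assoc, Module.End.mul_apply, Module.End.mul_apply, h.c_mul (by omega), map_zero]

end Bounded

/-- The terms of the fermionic part of the weight operator. -/
def virBC (φ : ℤ → K) (a : ι × ℤ) : Module.End K W :=
  φ a.2 • M.normalBC (B a.1) a.2 (B.coord a.1) (-a.2)

/-- The terms of the bosonic part of the weight operator. -/
def virBetaGamma (φ : ℤ → K) (a : ι × ℤ) : Module.End K W :=
  φ a.2 • M.normalBetaGamma (B a.1) a.2 (B.coord a.1) (-a.2)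

/-- The terms of the bosonic part of `Q`. -/
def qSym (a : (ι × ι) × (ℤ × ℤ)) : Module.End K W :=
  M.normalBetaGamma ⁅B a.1.1, B a.1.2⁆ (a.2.1 + a.2.2) (B.coord a.1.2) (-a.2.1) *
    M.c (-a.2.2) (B.coord a.1.1)

/-- The terms of the fermionic part of `Q`. -/
def qExt (a : (ι × ι) × (ℤ × ℤ)) : Module.End K W :=
  M.normalBCC ⁅B a.1.1, B a.1.2⁆ (a.2.1 + a.2.2) (B.coord a.1.2) (-a.2.1)
    (B.coord a.1.1) (-a.2.2)

theorem isLocallyFinite_virBC (φ : ℤ → K) : IsLocallyFinite (M.virBC B φ) := fun w => by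
  obtain ⟨N, hN⟩ := M.exists_isBounded w
  refine (finite_box N).subset fun a ha => ?_
  by_contra hb
  refine ha ?_
  rw [virBC, LinearMap.smul_apply,
    hN.normalBC_eq_zero (by simp only [Set.mem_ofPred_eq] at hb; omega), smul_zero]

theorem isLocallyFinite_virBetaGamma (φ : ℤ → K) : IsLocallyFinite (M.virBetaGamma B φ) :=
  fun w => by
  obtain ⟨N, hN⟩ := M.exists_isBounded w
  refine (finite_box N).subset fun a ha => ?_
  by_contra hb
  refine ha ?_
  rw [virBetaGamma, LinearMap.smul_apply,
    hN.normalBetaGamma_eq_zero (by simp only [Set.mem_ofPred_eq] at hb; omega), smul_zero]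

theorem finite_box_prod (N : ℤ) : {a : (ι × ι) × (ℤ × ℤ) |
    (-N ≤ a.2.1 ∧ a.2.1 ≤ N) ∧ (-N ≤ a.2.2 ∧ a.2.2 ≤ N)}.Finite :=
  (Set.finite_univ.prod ((Set.finite_Icc (-N) N).prod (Set.finite_Icc (-N) N))).subset
    fun _ ha => ⟨Set.mem_univ _, ha⟩

theorem isLocallyFinite_qSym : IsLocallyFinite (M.qSym B) := fun w => by
  obtain ⟨N, hN⟩ := M.exists_isBounded w
  refine (finite_box_prod (2 * N)).subset fun a ha => ?_
  by_contra hb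
  refine ha (hN.normalBetaGamma_c_eq_zero ?_ _ _ _)
  simp only [Set.mem_ofPred_eq] at hb
  have := hN.1
  omega

theorem isLocallyFinite_qExt : IsLocallyFinite (M.qExt B) := fun w => by
  obtain ⟨N, hN⟩ := M.exists_isBounded w
  refine (finite_box_prod (2 * N)).subset fun a ha => ?_
  by_contra hb
  refine ha (hN.normalBCC_eq_zero ?_ _ _ _)
  simp only [Set.mem_ofPred_eq] at hb
  have := hN.1
  omega

/-- Reordering produces the same contraction with opposite signs for commuting and anticommuting
modes. -/
theorem normal_add (x : ℓ) (m : ℤ) (f : Module.Dual K ℓ) (n : ℤ) :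
    M.normalBC x m f n + M.normalBetaGamma x m f n =
      M.b m x * M.c n f + M.beta m x * M.gamma n f := by
  rw [normalBC, normalBetaGamma]
  split_ifs with h
  · rw [M.gamma_beta, M.c_b]
    abel
  · rfl

/-- The anomalies of the two parts of the weight operator cancel. -/
theorem localSum_vir (φ : ℤ → K) :
    localSum (M.virBC B φ) + localSum (M.virBetaGamma B φ) = M.weight B φ := by
  rw [weight, k, anticommutator_localSum (M.isLocallyFinite_kFamily B φ),
    ← localSum_add (M.isLocallyFinite_virBC B φ) (M.isLocallyFinite_virBetaGamma B φ)]
  congr 1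
  ext1 a
  rw [virBC, virBetaGamma, ← smul_add, normal_add, kFamily, mul_smul_comm, smul_mul_assoc,
    ← smul_add, ← mul_assoc, h_beta, add_mul, mul_assoc, h_c]
  congr 1
  noncomm_ring

/-- Moving `b` through two `c`'s leaves two contractions, one for each `c`. The two bosonic terms,
antisymmetrised in the dual modes, produce exactly their negatives. -/
theorem normal_add_three (x : ℓ) (m : ℤ) (f : Module.Dual K ℓ) (n : ℤ) (g : Module.Dual K ℓ)
    (p : ℤ) :
    M.normalBCC x m f n g p + M.normalBetaGamma x m f n * M.c p g -
      M.normalBetaGamma x m g p * M.c n f =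
    M.b m x * M.c n f * M.c p g + M.beta m x * M.gamma n f * M.c p g -
      M.beta m x * M.gamma p g * M.c n f := by
  rw [normalBCC, normalBetaGamma, normalBetaGamma]
  split_ifs with h
  · rw [M.gamma_beta, M.gamma_beta, mul_assoc, M.c_b, mul_add, mul_neg, ← mul_assoc, M.c_b]
    simp only [add_mul, neg_mul, mul_smul_comm, smul_mul_assoc, mul_one, one_mul, mul_assoc, neg_add]
    abel
  · rfl

/-- The anomalies of the two parts of `Q` cancel. -/
theorem localSum_q : localSum (M.qExt B) + (localSum (M.qSym B) + localSum (M.qSym B)) =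
    M.Q B := by
  let s : (ι × ι) × (ℤ × ℤ) ≃ (ι × ι) × (ℤ × ℤ) :=
    (Equiv.prodComm _ _).prodCongr (Equiv.prodComm _ _)
  let e : (ι × ι) × (ℤ × ℤ) ≃ (ι × ℤ) × (ι × ℤ) :=
    { toFun := fun a => ((a.1.2, a.2.1), (a.1.1, a.2.2))
      invFun := fun p => ((p.2.1, p.1.1), (p.1.2, p.2.2))
      left_inv := fun p => rfl
      right_inv := fun p => rfl }
  have hR := M.isLocallyFinite_rFamily B
  have hS := M.isLocallyFinite_qSym B
  have hR' := (hR.mul_left (M.h B)).sub (hR.mul_right (M.h B))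
  rw [Q, R, commutator_localSum hR, ← localSum_comp_equiv hR' e]
  -- Of the two copies of the bosonic sum one is reindexed by exchanging `u, v` and `i, j`. This
  -- yields the term in which `h` acts on the other `c`.
  nth_rw 2 [← localSum_comp_equiv hS s]
  rw [← localSum_add hS (hS.comp_injective s.injective),
    ← localSum_add (M.isLocallyFinite_qExt B) (hS.add (hS.comp_injective s.injective))]
  congr 1
  ext1 a
  obtain ⟨⟨u, v⟩, ⟨i, j⟩⟩ := a
  change M.normalBCC ⁅B u, B v⁆ (i + j) (B.coord v) (-i) (B.coord u) (-j) +
    (M.normalBetaGamma ⁅B u, B v⁆ (i + j) (B.coord v) (-i) * M.c (-j) (B.coord u) +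
    M.normalBetaGamma ⁅B v, B u⁆ (j + i) (B.coord u) (-j) * M.c (-i) (B.coord v)) =
    M.h B * (M.beta (j + i) ⁅B u, B v⁆ * M.c (-i) (B.coord v) * M.c (-j) (B.coord u)) -
    M.beta (j + i) ⁅B u, B v⁆ * M.c (-i) (B.coord v) * M.c (-j) (B.coord u) * M.h B
  have e : M.normalBetaGamma ⁅B v, B u⁆ (j + i) (B.coord u) (-j) =
      -M.normalBetaGamma ⁅B u, B v⁆ (i + j) (B.coord u) (-j) := by
    rw [← lie_skew, add_comm j i]
    simp only [normalBetaGamma, map_neg, mul_neg, neg_mul]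
    split_ifs <;> rfl
  rw [e, neg_mul, ← add_assoc, ← sub_eq_add_neg, normal_add_three, add_comm j i]
  have e2 : M.h B * (M.beta (i + j) ⁅B u, B v⁆ * M.c (-i) (B.coord v) * M.c (-j) (B.coord u)) =
      M.beta (i + j) ⁅B u, B v⁆ * M.c (-i) (B.coord v) * M.c (-j) (B.coord u) * M.h B +
      M.b (i + j) ⁅B u, B v⁆ * M.c (-i) (B.coord v) * M.c (-j) (B.coord u) +
      M.beta (i + j) ⁅B u, B v⁆ * M.gamma (-i) (B.coord v) * M.c (-j) (B.coord u) -
      M.beta (i + j) ⁅B u, B v⁆ * M.c (-i) (B.coord v) * M.gamma (-j) (B.coord u) := by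
    rw [← mul_assoc, ← mul_assoc, h_beta, add_mul, add_mul, mul_assoc (M.beta _ _), h_c, mul_add,
      mul_neg, ← mul_assoc, add_mul, neg_mul, mul_assoc (_ * _) (M.h B), h_c]
    noncomm_ring
  rw [e2, mul_assoc _ _ (M.gamma _ _), M.c_gamma]
  noncomm_ring

end Fintype

end ModeRep

/-! ### Contractions and multiplications on symmetric and exterior algebras. -/

section Sym

variable {K : Type*} [Field K] {V V' : Type*} [AddCommMonoid V] [Module K V]
  [AddCommMonoid V'] [Module K V']

theorem symContract_ι (φ : Module.Dual K V) (v : V) :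
    symContract φ (SymmetricAlgebra.ι K V v) = algebraMap K _ (φ v) := by
  simp [symContract, symDer_ι, Algebra.algebraMap_eq_smul_one]

theorem symContract_algebraMap (φ : Module.Dual K V) (r : K) :
    symContract φ (algebraMap K (SymmetricAlgebra K V) r) = 0 :=
  Derivation.map_algebraMap _ _

theorem symContract_mul (φ : Module.Dual K V) (p q : SymmetricAlgebra K V) :
    symContract φ (p * q) = p * symContract φ q + q * symContract φ p :=
  Derivation.leibniz _ _ _

theorem symContract_add (φ ψ : Module.Dual K V) :
    symContract (φ + ψ) = symContract φ + symContract ψ := by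
  ext p
  induction p using SymmetricAlgebra.induction with
  | algebraMap r => simp [symContract_algebraMap]
  | ι x => simp [symContract_ι]
  | mul a b ha hb =>
    rw [LinearMap.add_apply] at *
    simp only [symContract_mul, ha, hb]
    ring
  | add a b ha hb => simp only [map_add, ha, hb]

theorem symContract_smul (r : K) (φ : Module.Dual K V) :
    symContract (r • φ) = r • symContract φ := by
  ext p
  induction p using SymmetricAlgebra.induction with
  | algebraMap r => simp [symContract_algebraMap]
  | ι x => simp [symContract_ι, Algebra.smul_def]
  | mul a b ha hb =>
    rw [LinearMap.smul_apply] at *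
    simp only [symContract_mul, ha, hb, mul_smul_comm, smul_add]
  | add a b ha hb => simp only [map_add, ha, hb]

/-- The contraction of a symmetric algebra, as a function of the linear form. -/
def symContractHom : Module.Dual K V →ₗ[K] Module.End K (SymmetricAlgebra K V) where
  toFun := symContract
  map_add' := symContract_add
  map_smul' := symContract_smul

/-- The multiplication of a symmetric algebra by generators. -/
def symMulHom : V →ₗ[K] Module.End K (SymmetricAlgebra K V) :=
  (LinearMap.mul K (SymmetricAlgebra K V)) ∘ₗ SymmetricAlgebra.ι K V

/-- The map of symmetric algebras induced by a linear map. -/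
abbrev symMap (g : V →ₗ[K] V') : SymmetricAlgebra K V →ₐ[K] SymmetricAlgebra K V' :=
  SymmetricAlgebra.lift (SymmetricAlgebra.ι K V' ∘ₗ g)

theorem symContract_symMap (g : V →ₗ[K] V') (φ : Module.Dual K V') (p : SymmetricAlgebra K V) :
    symContract φ (symMap g p) = symMap g (symContract (φ ∘ₗ g) p) := by
  induction p using SymmetricAlgebra.induction with
  | algebraMap r => simp only [AlgHom.commutes, symContract_algebraMap, map_zero]
  | ι x => simp [symContract_ι]
  | mul a b ha hb => simp only [map_mul, symContract_mul, ha, hb, map_add]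
  | add a b ha hb => simp only [map_add, ha, hb]

/-- An element involves finitely many generators, and a derivation that kills these kills it. The
bound is uniform over the set `Φ m`, as the smoothness of the Fock module requires. -/
theorem exists_symContract_eq_zero (Φ : ℕ → Set (Module.Dual K V))
    (hΦ : ∀ v, ∃ N, ∀ m, N ≤ m → ∀ φ ∈ Φ m, φ v = 0) (p : SymmetricAlgebra K V) :
    ∃ N, ∀ m, N ≤ m → ∀ φ ∈ Φ m, symContract φ p = 0 := by
  induction p using SymmetricAlgebra.induction with
  | algebraMap r => exact ⟨0, fun m _ φ _ => symContract_algebraMap _ _⟩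
  | ι x =>
    obtain ⟨N, hN⟩ := hΦ x
    exact ⟨N, fun m hm φ hφ => by rw [symContract_ι, hN m hm φ hφ, map_zero]⟩
  | mul a b ha hb =>
    obtain ⟨N, hN⟩ := ha
    obtain ⟨N', hN'⟩ := hb
    exact ⟨max N N', fun m hm φ hφ => by
      rw [symContract_mul, hN m (le_of_max_le_left hm) φ hφ, hN' m (le_of_max_le_right hm) φ hφ,
        mul_zero, mul_zero, add_zero]⟩
  | add a b ha hb =>
    obtain ⟨N, hN⟩ := ha
    obtain ⟨N', hN'⟩ := hb
    exact ⟨max N N', fun m hm φ hφ => by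
      rw [map_add, hN m (le_of_max_le_left hm) φ hφ, hN' m (le_of_max_le_right hm) φ hφ,
        add_zero]⟩

end Sym

section Ext

variable {K : Type*} [Field K] {V V' : Type*} [AddCommGroup V] [Module K V]
  [AddCommGroup V'] [Module K V']

theorem extContract_algebraMap (φ : Module.Dual K V) (r : K) :
    extContract φ (algebraMap K (ExteriorAlgebra K V) r) = 0 :=
  CliffordAlgebra.contractLeft_algebraMap _ _ _

theorem extContract_ι_mul (φ : Module.Dual K V) (v : V) (q : ExteriorAlgebra K V) :
    extContract φ (ExteriorAlgebra.ι K v * q) =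
      φ v • q - ExteriorAlgebra.ι K v * extContract φ q :=
  CliffordAlgebra.contractLeft_ι_mul _ _ _

theorem extAlgebra_left_induction {P : ExteriorAlgebra K V → Prop}
    (algebraMap : ∀ r : K, P (algebraMap K _ r))
    (add : ∀ x y, P x → P y → P (x + y))
    (ι_mul : ∀ x v, P x → P (ExteriorAlgebra.ι K v * x)) (q : ExteriorAlgebra K V) : P q :=
  CliffordAlgebra.left_induction (Q := (0 : QuadraticForm K V)) (P := P) algebraMap add ι_mul q

theorem extContract_map (g : V →ₗ[K] V') (φ : Module.Dual K V') (q : ExteriorAlgebra K V) :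
    extContract φ (ExteriorAlgebra.map g q) = ExteriorAlgebra.map g (extContract (φ ∘ₗ g) q) := by
  induction q using extAlgebra_left_induction with
  | algebraMap r => simp only [AlgHom.commutes, extContract_algebraMap, map_zero]
  | add a b ha hb => simp only [map_add, ha, hb]
  | ι_mul x v hx =>
    simp only [map_mul, ExteriorAlgebra.map_apply_ι, extContract_ι_mul, hx, map_sub, map_smul,
      LinearMap.comp_apply]

theorem exists_extContract_eq_zero (Φ : ℕ → Set (Module.Dual K V))
    (hΦ : ∀ v, ∃ N, ∀ m, N ≤ m → ∀ φ ∈ Φ m, φ v = 0) (q : ExteriorAlgebra K V) :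
    ∃ N, ∀ m, N ≤ m → ∀ φ ∈ Φ m, extContract φ q = 0 := by
  induction q using extAlgebra_left_induction with
  | algebraMap r => exact ⟨0, fun m _ φ _ => extContract_algebraMap _ _⟩
  | add a b ha hb =>
    obtain ⟨N, hN⟩ := ha
    obtain ⟨N', hN'⟩ := hb
    exact ⟨max N N', fun m hm φ hφ => by
      rw [map_add, hN m (le_of_max_le_left hm) φ hφ, hN' m (le_of_max_le_right hm) φ hφ,
        add_zero]⟩
  | ι_mul x v hx =>
    obtain ⟨N, hN⟩ := hx
    obtain ⟨N', hN'⟩ := hΦ v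
    exact ⟨max N N', fun m hm φ hφ => by
      rw [extContract_ι_mul, hN m (le_of_max_le_left hm) φ hφ,
        hN' m (le_of_max_le_right hm) φ hφ, mul_zero, zero_smul, sub_zero]⟩

/-- The contraction of an exterior algebra, as a function of the linear form. -/
def extContractHom : Module.Dual K V →ₗ[K] Module.End K (ExteriorAlgebra K V) :=
  CliffordAlgebra.contractLeft

/-- The multiplication of an exterior algebra by generators. -/
def extMulHom : V →ₗ[K] Module.End K (ExteriorAlgebra K V) :=
  (LinearMap.mul K (ExteriorAlgebra K V)) ∘ₗ ExteriorAlgebra.ι K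

/-- A subspace of `SV ⊗ ΛV` that contains `1` and is stable under multiplication by generators
is the whole space. -/
theorem sym_ext_cyclic (p : Submodule K (SymmetricAlgebra K V ⊗[K] ExteriorAlgebra K V))
    (h1 : (1 : SymmetricAlgebra K V) ⊗ₜ[K] (1 : ExteriorAlgebra K V) ∈ p)
    (hs : ∀ v, ∀ w ∈ p, TensorProduct.map (symMul v) LinearMap.id w ∈ p)
    (he : ∀ v, ∀ w ∈ p, TensorProduct.map LinearMap.id (extMul v) w ∈ p) : p = ⊤ := by
  have hs' (s : SymmetricAlgebra K V) : ∀ w ∈ p,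
      TensorProduct.map (LinearMap.mulLeft K s) LinearMap.id w ∈ p := by
    induction s using SymmetricAlgebra.induction with
    | algebraMap r =>
      intro w hw
      have : LinearMap.mulLeft K (algebraMap K (SymmetricAlgebra K V) r) = r • LinearMap.id := by
        ext x
        simp [Algebra.smul_def]
      rw [this, TensorProduct.map_smul_left, TensorProduct.map_id]
      exact p.smul_mem _ hw
    | ι x => exact hs x
    | mul a b ha hb =>
      intro w hw
      have := ha _ (hb w hw)
      rwa [← LinearMap.comp_apply, ← TensorProduct.map_comp, ← LinearMap.mulLeft_mul] at this
    | add a b ha hb =>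
      intro w hw
      have : LinearMap.mulLeft K (a + b) = LinearMap.mulLeft K a + LinearMap.mulLeft K b := by
        ext x
        simp [add_mul]
      rw [this, TensorProduct.map_add_left]
      exact p.add_mem (ha w hw) (hb w hw)
  have he' (q : ExteriorAlgebra K V) : (1 : SymmetricAlgebra K V) ⊗ₜ[K] q ∈ p := by
    induction q using extAlgebra_left_induction with
    | algebraMap r =>
      rw [Algebra.algebraMap_eq_smul_one, TensorProduct.tmul_smul]
      exact p.smul_mem _ h1
    | add a b ha hb =>
      rw [TensorProduct.tmul_add]
      exact p.add_mem ha hb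
    | ι_mul x v hx => exact he v _ hx
  rw [eq_top_iff]
  rintro w -
  induction w using TensorProduct.induction_on with
  | zero => exact p.zero_mem
  | tmul s q => simpa using hs' s _ (he' q)
  | add a b ha hb => exact p.add_mem ha hb

end Ext

/-! ### Transfer of the relations to the factors of a tensor product. -/

section Tensor

variable {K : Type*} [Field K] {S E : Type*} [AddCommGroup S] [Module K S]
  [AddCommGroup E] [Module K E]

theorem rTensor_relation {x y x' y' : Module.End K S} {r : K}
    (h : ∀ w, x (y w) - x' (y' w) = r • w) :
    x.rTensor E * y.rTensor E = x'.rTensor E * y'.rTensor E + r • (1 : Module.End K (S ⊗[K] E)) := by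
  have : x * y = x' * y' + r • 1 := LinearMap.ext fun w => sub_eq_iff_eq_add'.1 (h w)
  rw [← LinearMap.rTensor_mul, this, LinearMap.rTensor_add, LinearMap.rTensor_smul,
    LinearMap.rTensor_mul, Module.End.one_eq_id, LinearMap.rTensor_id, Module.End.one_eq_id]

theorem rTensor_commute {x y : Module.End K S} (h : ∀ w, x (y w) - y (x w) = 0) :
    x.rTensor E * y.rTensor E = y.rTensor E * x.rTensor E := by
  simpa using rTensor_relation (E := E) (x := x) (y := y) (x' := y) (y' := x) (r := (0 : K))
    (by simpa using h)

theorem lTensor_relation {x y x' y' : Module.End K E} {r : K}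
    (h : ∀ w, x (y w) + x' (y' w) = r • w) :
    x.lTensor S * y.lTensor S =
      -(x'.lTensor S * y'.lTensor S) + r • (1 : Module.End K (S ⊗[K] E)) := by
  have : x * y = -(x' * y') + r • 1 :=
    LinearMap.ext fun w => (eq_sub_of_add_eq (h w)).trans (sub_eq_neg_add _ _)
  rw [← LinearMap.lTensor_mul, this, LinearMap.lTensor_add, LinearMap.lTensor_smul,
    LinearMap.lTensor_neg, LinearMap.lTensor_mul, Module.End.one_eq_id, LinearMap.lTensor_id,
    Module.End.one_eq_id]

theorem lTensor_anticommute {x y : Module.End K E} (h : ∀ w, x (y w) + y (x w) = 0) :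
    x.lTensor S * y.lTensor S = -(y.lTensor S * x.lTensor S) := by
  simpa using lTensor_relation (S := S) (x := x) (y := y) (x' := y) (y' := x) (r := (0 : K))
    (by simpa using h)

theorem rTensor_mul_lTensor (x : Module.End K S) (y : Module.End K E) :
    x.rTensor E * y.lTensor S = TensorProduct.map x y :=
  LinearMap.rTensor_comp_lTensor _ _ _

theorem lTensor_mul_rTensor (x : Module.End K S) (y : Module.End K E) :
    y.lTensor S * x.rTensor E = x.rTensor E * y.lTensor S :=
  (LinearMap.lTensor_comp_rTensor _ _ _).trans (LinearMap.rTensor_comp_lTensor _ _ _).symm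

end Tensor

/-! ### The Fock space as a smooth representation of the modes. -/

section Fock

variable (K : Type*) [Field K] (ℓ : Type*) [LieRing ℓ] [LieAlgebra K ℓ]

/-- The linear forms of index `m` on the creation operators. -/
def pairings (m : ℕ) : Set (Module.Dual K (Creation K ℓ)) :=
  Set.range (fun x => pairVec K x m) ∪ Set.range fun f => pairDual f m

theorem exists_pairings_eq_zero (v : Creation K ℓ) :
    ∃ N, ∀ m, N ≤ m → ∀ φ ∈ pairings K ℓ m, φ v = 0 := by
  refine ⟨(v.1.support.sup id ⊔ v.2.support.sup id) + 1, fun m hm φ hφ => ?_⟩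
  rcases hφ with ⟨x, rfl⟩ | ⟨f, rfl⟩
  · have : v.1 m = 0 := by
      by_contra h
      have := Finset.le_sup (f := id) (Finsupp.mem_support_iff.2 h)
      simp only [id] at this
      omega
    simp [pairVec, this]
  · have : v.2 m = 0 := by
      by_contra h
      have := Finset.le_sup (f := id) (Finsupp.mem_support_iff.2 h)
      simp only [id] at this
      omega
    simp [pairDual, this]

variable {K ℓ}

theorem beta_gamma_eq_zero {N : ℕ} {p : SymModule K ℓ}
    (h : ∀ m, N ≤ m → ∀ φ ∈ pairings K ℓ m, symContract φ p = 0) {n : ℤ} (hn : (N : ℤ) + 1 ≤ n) :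
    (∀ x, betaMode K x n p = 0) ∧ ∀ f, gammaMode f n p = 0 := by
  constructor
  · intro x
    obtain ⟨n, rfl⟩ := Int.eq_ofNat_of_zero_le (by omega : 0 ≤ n)
    change -symContract (pairVec K x n) p = 0
    rw [h n (by omega) _ (Or.inl ⟨x, rfl⟩), neg_zero]
  · intro f
    obtain ⟨n, rfl⟩ : ∃ k : ℕ, n = -Int.negSucc k := ⟨(n - 1).toNat, by omega⟩
    rw [gammaMode_neg_negSucc, h n (by omega) _ (Or.inr ⟨f, rfl⟩)]

theorem b_c_eq_zero {N : ℕ} {q : ExtModule K ℓ}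
    (h : ∀ m, N ≤ m → ∀ φ ∈ pairings K ℓ m, extContract φ q = 0) {n : ℤ} (hn : (N : ℤ) + 1 ≤ n) :
    (∀ x, bMode K x n q = 0) ∧ ∀ f, cMode f n q = 0 := by
  constructor
  · intro x
    obtain ⟨n, rfl⟩ := Int.eq_ofNat_of_zero_le (by omega : 0 ≤ n)
    exact h n (by omega) _ (Or.inl ⟨x, rfl⟩)
  · intro f
    obtain ⟨n, rfl⟩ : ∃ k : ℕ, n = -Int.negSucc k := ⟨(n - 1).toNat, by omega⟩
    rw [cMode_neg_negSucc, h n (by omega) _ (Or.inr ⟨f, rfl⟩)]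

/-- The linear map `x ↦ (f ↦ ⟨f, x⟩)` at index `m`. -/
def pairVecHom (m : ℕ) : ℓ →ₗ[K] Module.Dual K (Creation K ℓ) :=
  LinearMap.lcomp K K (Finsupp.lapply m ∘ₗ LinearMap.fst K _ _) ∘ₗ Module.Dual.eval K ℓ

/-- The linear map `f ↦ (x ↦ ⟨f, x⟩)` at index `m`. -/
def pairDualHom (m : ℕ) : Module.Dual K ℓ →ₗ[K] Module.Dual K (Creation K ℓ) :=
  LinearMap.lcomp K K (Finsupp.lapply m ∘ₗ LinearMap.snd K _ _)

/-- The operators `β_n^x` as a linear map in `x`. -/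
def betaHom : ℤ → ℓ →ₗ[K] Module.End K (SymModule K ℓ)
  | Int.ofNat m => -(symContractHom ∘ₗ pairVecHom m)
  | Int.negSucc m => symMulHom ∘ₗ LinearMap.inr K _ _ ∘ₗ Finsupp.lsingle m

theorem betaHom_apply (x : ℓ) (n : ℤ) : betaHom n x = betaMode K x n := by
  rcases n with n | n <;> rfl

/-- The operators `b_n^x` as a linear map in `x`. -/
def bHom : ℤ → ℓ →ₗ[K] Module.End K (ExtModule K ℓ)
  | Int.ofNat m => extContractHom ∘ₗ pairVecHom m
  | Int.negSucc m => extMulHom ∘ₗ LinearMap.inr K _ _ ∘ₗ Finsupp.lsingle m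

theorem bHom_apply (x : ℓ) (n : ℤ) : bHom n x = bMode K x n := by
  rcases n with n | n <;> rfl

/-- The operators `γ_{-n}^f` as a linear map in `f`. -/
def gammaHom : ℤ → Module.Dual K ℓ →ₗ[K] Module.End K (SymModule K ℓ)
  | Int.ofNat m => symMulHom ∘ₗ LinearMap.inl K _ _ ∘ₗ Finsupp.lsingle m
  | Int.negSucc m => symContractHom ∘ₗ pairDualHom m

theorem gammaHom_apply (f : Module.Dual K ℓ) (n : ℤ) : gammaHom (-n) f = gammaMode f n := by
  obtain ⟨n, rfl⟩ : ∃ k, n = -k := ⟨-n, by simp⟩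
  rw [neg_neg]
  rcases n with n | n
  · rw [gammaMode_neg_ofNat]; rfl
  · rw [gammaMode_neg_negSucc]; rfl

/-- The operators `c_{-n}^f` as a linear map in `f`. -/
def cHom : ℤ → Module.Dual K ℓ →ₗ[K] Module.End K (ExtModule K ℓ)
  | Int.ofNat m => extMulHom ∘ₗ LinearMap.inl K _ _ ∘ₗ Finsupp.lsingle m
  | Int.negSucc m => extContractHom ∘ₗ pairDualHom m

theorem cHom_apply (f : Module.Dual K ℓ) (n : ℤ) : cHom (-n) f = cMode f n := by
  obtain ⟨n, rfl⟩ : ∃ k, n = -k := ⟨-n, by simp⟩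
  rw [neg_neg]
  rcases n with n | n
  · rw [cMode_neg_ofNat]; rfl
  · rw [cMode_neg_negSucc]; rfl

variable (K ℓ)

/-- The semi-infinite Weil complex as a representation of the modes. -/
def fockRep : ModeRep K ℓ (SemiInfWeil K ℓ) where
  beta n := LinearMap.rTensorHom _ ∘ₗ betaHom n
  gamma n := LinearMap.rTensorHom _ ∘ₗ gammaHom (-n)
  b n := LinearMap.lTensorHom _ ∘ₗ bHom n
  c n := LinearMap.lTensorHom _ ∘ₗ cHom (-n)
  gamma_beta n m f x := by
    simp only [LinearMap.comp_apply, LinearMap.coe_rTensorHom,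
      betaHom_apply, gammaHom_apply]
    exact rTensor_relation (gammaMode_betaMode f x m n)
  beta_beta m n x y := by
    simp only [LinearMap.comp_apply, LinearMap.coe_rTensorHom,
      betaHom_apply]
    exact rTensor_commute (betaMode_betaMode x y m n)
  gamma_gamma m n f g := by
    simp only [LinearMap.comp_apply, LinearMap.coe_rTensorHom,
      gammaHom_apply]
    exact rTensor_commute (gammaMode_gammaMode f g m n)
  c_b n m f x := by
    simp only [LinearMap.comp_apply, LinearMap.coe_lTensorHom,
      bHom_apply, cHom_apply]
    exact lTensor_relation (cMode_bMode f x m n)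
  b_b m n x y := by
    simp only [LinearMap.comp_apply, LinearMap.coe_lTensorHom,
      bHom_apply]
    exact lTensor_anticommute (bMode_bMode x y m n)
  c_c m n f g := by
    simp only [LinearMap.comp_apply, LinearMap.coe_lTensorHom,
      cHom_apply]
    exact lTensor_anticommute (cMode_cMode f g m n)
  b_beta _ _ _ _ := lTensor_mul_rTensor _ _
  b_gamma _ _ _ _ := lTensor_mul_rTensor _ _
  c_beta _ _ _ _ := lTensor_mul_rTensor _ _
  c_gamma _ _ _ _ := lTensor_mul_rTensor _ _
  bounded w := by
    simp only [LinearMap.comp_apply, LinearMap.coe_rTensorHom,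
      LinearMap.coe_lTensorHom, bHom_apply, cHom_apply,
      betaHom_apply, gammaHom_apply]
    induction w using TensorProduct.induction_on with
    | zero => exact ⟨1, le_rfl, fun n _ => by simp⟩
    | tmul p q =>
      obtain ⟨N, hN⟩ := exists_symContract_eq_zero _ (exists_pairings_eq_zero K ℓ) p
      obtain ⟨N', hN'⟩ := exists_extContract_eq_zero _ (exists_pairings_eq_zero K ℓ) q
      refine ⟨max N N' + 1, by omega, fun n hn => ?_⟩
      have h1 := beta_gamma_eq_zero hN (n := n) (by omega)
      have h2 := b_c_eq_zero hN' (n := n) (by omega)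
      simp [h1, h2]
    | add v w hv hw =>
      obtain ⟨N, h1, hN⟩ := hv
      obtain ⟨N', h1', hN'⟩ := hw
      refine ⟨max N N', by omega, fun n hn => ?_⟩
      have h2 := hN n (by omega)
      have h3 := hN' n (by omega)
      simp [h2, h3]

end Fock

/-! ### Vectors killed by all positive modes, and splitting by weights. -/

namespace ModeRep

variable {K ℓ W : Type*} [Field K] [LieRing ℓ] [LieAlgebra K ℓ] [AddCommGroup W]
    [Module K W] {M : ModeRep K ℓ W} {ι : Type*} [Fintype ι] (B : Module.Basis ι K ℓ) {w : W}

/-- The indices of a term are opposite, so unless both are zero one is positive and kills the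
vector. -/
theorem IsBounded.h_apply (hw : M.IsBounded 1 w) :
    M.h B w = ∑ u, M.gamma 0 (B.coord u) (M.b 0 (B u) w) := by
  rw [h, localSum_apply_eq_sum (M.isLocallyFinite_hFamily B) (Finset.univ ×ˢ {0}) w,
    Finset.sum_product]
  · simp [hFamily]
  · intro a ha
    refine hw.gamma_b_eq_zero ?_ _ _
    have : a.2 ≠ 0 := fun h => ha (Finset.mem_product.2
      ⟨Finset.mem_univ _, Finset.mem_singleton.2 h⟩)
    omega

theorem IsBounded.k_apply (hw : M.IsBounded 1 w) {φ : ℤ → K} (hφ : φ 0 = 0) :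
    M.k B φ w = 0 := by
  rw [k, localSum_apply_eq_sum (M.isLocallyFinite_kFamily B φ) ∅ w, Finset.sum_empty]
  intro a _
  rw [kFamily, LinearMap.smul_apply]
  by_cases h : a.2 = 0
  · rw [h, hφ, zero_smul]
  · rw [hw.beta_c_eq_zero (by omega), smul_zero]

/-- The normally ordered form of the weight kills `w` term by term. The definition as `hk + kh`
would require control of `h w` as well. -/
theorem IsBounded.weight_apply (hw : M.IsBounded 1 w) {φ : ℤ → K} (hφ : φ 0 = 0) :
    M.weight B φ w = 0 := by
  rw [← localSum_vir, LinearMap.add_apply,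
    localSum_apply_eq_sum (M.isLocallyFinite_virBC B φ) ∅ w, Finset.sum_empty,
    localSum_apply_eq_sum (M.isLocallyFinite_virBetaGamma B φ) ∅ w, Finset.sum_empty, add_zero]
  all_goals
    intro a _
    simp only [virBC, virBetaGamma, LinearMap.smul_apply]
    by_cases h : a.2 = 0
    · rw [h, hφ, zero_smul]
  · rw [hw.normalBetaGamma_eq_zero (by omega), smul_zero]
  · rw [hw.normalBC_eq_zero (by omega), smul_zero]

theorem IsBounded.localSum_qSym_apply (hw : M.IsBounded 1 w) :
    localSum (M.qSym B) w =
      ∑ u, ∑ v, M.gamma 0 (B.coord v) (M.beta 0 ⁅B u, B v⁆ (M.c 0 (B.coord u) w)) := by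
  rw [localSum_apply_eq_sum (M.isLocallyFinite_qSym B)
    (Finset.univ ×ˢ {(0, 0)}) w, Finset.sum_product, ← Finset.univ_product_univ,
    Finset.sum_product]
  · simp [qSym, normalBetaGamma]
  · intro a ha
    refine hw.normalBetaGamma_c_eq_zero ?_ _ _ _
    have : a.2 ≠ (0, 0) := fun h => ha (Finset.mem_product.2
      ⟨Finset.mem_univ _, Finset.mem_singleton.2 h⟩)
    rw [Ne, Prod.ext_iff] at this
    simp only at this
    omega

theorem IsBounded.localSum_qExt_apply (hw : M.IsBounded 1 w) :
    localSum (M.qExt B) w =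
      ∑ u, ∑ v, M.c 0 (B.coord v) (M.c 0 (B.coord u) (M.b 0 ⁅B u, B v⁆ w)) := by
  rw [localSum_apply_eq_sum (M.isLocallyFinite_qExt B)
    (Finset.univ ×ˢ {(0, 0)}) w, Finset.sum_product, ← Finset.univ_product_univ,
    Finset.sum_product]
  · simp [qExt, normalBCC]
  · intro a ha
    refine hw.normalBCC_eq_zero ?_ _ _ _
    have : a.2 ≠ (0, 0) := fun h => ha (Finset.mem_product.2
      ⟨Finset.mem_univ _, Finset.mem_singleton.2 h⟩)
    rw [Ne, Prod.ext_iff] at this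
    simp only at this
    omega

/-- The creation operators generate the whole space from `v`. -/
def IsCyclic (M : ModeRep K ℓ W) (v : W) : Prop := ∀ p : Submodule K W, v ∈ p →
    (∀ m : ℕ, ∀ x, ∀ w ∈ p, M.beta (Int.negSucc m) x w ∈ p) →
    (∀ m : ℕ, ∀ x, ∀ w ∈ p, M.b (Int.negSucc m) x w ∈ p) →
    (∀ m : ℕ, ∀ f, ∀ w ∈ p, M.gamma (-Int.ofNat m) f w ∈ p) →
    (∀ m : ℕ, ∀ f, ∀ w ∈ p, M.c (-Int.ofNat m) f w ∈ p) → p = ⊤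

/-- The creation operators serve as the raising operators. The modes `β`, `b` must have positive
weight, while `γ`, `c` may have weight zero if they preserve the image of `i`; this covers both `L₀`
and the count of generators. -/
theorem IsCyclic.isKernelSplit_weight [CharZero K] {v : W} (hcyc : M.IsCyclic v)
    {U : Type*} [AddCommGroup U] [Module K U]
    {i : U →ₗ[K] W} (hi : Function.Injective i) (φ : ℤ → K)
    (hL : ∀ a, M.weight B φ (i a) = 0) (hv : v ∈ LinearMap.range i)
    (hneg : ∀ m : ℕ, ∃ n : ℕ, φ (Int.negSucc m) = n + 1)
    (hpos : ∀ m : ℕ, ∃ n : ℕ, -φ (Int.ofNat m) = n ∧ (n = 0 → ∀ f a,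
      M.gamma (-Int.ofNat m) f (i a) ∈ LinearMap.range i ∧
      M.c (-Int.ofNat m) f (i a) ∈ LinearMap.range i)) :
    IsKernelSplit i (M.weight B φ) := by
  refine isKernelSplit_of_raising hi hL
    {T | (∃ m x, T = M.beta (Int.negSucc m) x) ∨
      (∃ m x, T = M.b (Int.negSucc m) x) ∨
      (∃ m f, T = M.gamma (-Int.ofNat m) f) ∨
      ∃ m f, T = M.c (-Int.ofNat m) f} ?_ ?_
  · rintro T (⟨m, x, rfl⟩ | ⟨m, x, rfl⟩ | ⟨m, f, rfl⟩ | ⟨m, f, rfl⟩)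
    · obtain ⟨n, hn⟩ := hneg m
      refine ⟨n + 1, ?_, fun h => absurd h (Nat.succ_ne_zero n)⟩
      rw [M.weight_beta, hn, add_sub_cancel_left, Nat.cast_succ]
    · obtain ⟨n, hn⟩ := hneg m
      refine ⟨n + 1, ?_, fun h => absurd h (Nat.succ_ne_zero n)⟩
      rw [weight_b, hn, add_sub_cancel_left, Nat.cast_succ]
    · obtain ⟨n, hn, h0⟩ := hpos m
      refine ⟨n, ?_, fun h a => (h0 h f a).1⟩
      rw [weight_gamma, neg_neg, ← hn, neg_smul]
      abel
    · obtain ⟨n, hn, h0⟩ := hpos m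
      refine ⟨n, ?_, fun h a => (h0 h f a).2⟩
      rw [weight_c, neg_neg, ← hn, neg_smul]
      abel
  · intro p hp hA
    exact hcyc p (hp hv) (fun m x => hA _ (Or.inl ⟨m, x, rfl⟩))
      (fun m x => hA _ (Or.inr (Or.inl ⟨m, x, rfl⟩)))
      (fun m f => hA _ (Or.inr (Or.inr (Or.inl ⟨m, f, rfl⟩))))
      (fun m f => hA _ (Or.inr (Or.inr (Or.inr ⟨m, f, rfl⟩))))

end ModeRep

/-! ### Coadjoint actions through multiplications and contractions. -/

section Sums

variable {K : Type*} [Field K] {E ι : Type*} [AddCommGroup E] [Module K E]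

theorem sum_neg_sum_comp (s : Finset ι) (r : ι → ι → K) (m c : ι → Module.End K E) :
    ∑ v ∈ s, (-∑ w ∈ s, r v w • m w) ∘ₗ c v = -∑ w ∈ s, m w ∘ₗ ∑ v ∈ s, r v w • c v := by
  simp only [← Module.End.mul_eq_comp, neg_mul, Finset.sum_mul, Finset.mul_sum, smul_mul_assoc,
    mul_smul_comm]
  rw [Finset.sum_neg_distrib, Finset.sum_comm]

theorem comp_neg_sum (s : Finset ι) (f : Module.End K E) (m c : ι → Module.End K E)
    (h : ∀ v q, m v (f q) + f (m v q) = 0) :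
    f ∘ₗ (-∑ v ∈ s, m v ∘ₗ c v) = ∑ v ∈ s, m v ∘ₗ f ∘ₗ c v := by
  simp only [← Module.End.mul_eq_comp]
  rw [mul_neg, Finset.mul_sum, ← Finset.sum_neg_distrib]
  refine Finset.sum_congr rfl fun v _ => LinearMap.ext fun q => ?_
  exact (eq_neg_of_add_eq_zero_left (h v (c v q))).symm

end Sums

section Classical

variable {K : Type*} [Field K] {ℓ : Type*} [LieRing ℓ] [LieAlgebra K ℓ]
  {ι : Type*} [Fintype ι] (B : Module.Basis ι K ℓ)

theorem lie_dual_eq_sum (x : ℓ) (f : Module.Dual K ℓ) :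
    ⁅x, f⁆ = -∑ v, f ⁅x, B v⁆ • B.coord v := by
  rw [← B.sum_dual_apply_smul_coord ⁅x, f⁆, ← Finset.sum_neg_distrib]
  refine Finset.sum_congr rfl fun v _ => ?_
  rw [Module.Dual.lie_apply]
  exact neg_smul (f ⁅x, B v⁆) (B.coord v)

/-- Both sides are derivations and agree on generators by the dual basis expansion. The sign is
attached to the contraction because that is how `β_0` acts. -/
theorem thetaSym_eq_sum (x : ℓ) : thetaSym x =
    ∑ v, symMul (B.coord v) ∘ₗ (-symContract (Module.Dual.eval K ℓ ⁅x, B v⁆)) := by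
  ext p
  rw [LinearMap.sum_apply]
  simp only [LinearMap.comp_apply, LinearMap.neg_apply, symMul, LinearMap.mulLeft_apply]
  induction p using SymmetricAlgebra.induction with
  | algebraMap r =>
    simp only [symContract_algebraMap, neg_zero, mul_zero, Finset.sum_const_zero]
    exact Derivation.map_algebraMap _ _
  | ι f =>
    refine (symDer_ι _ f).trans ?_
    rw [LinearMap.comp_apply, LieModule.toEnd_apply_apply, lie_dual_eq_sum B, map_neg, map_sum,
      ← Finset.sum_neg_distrib]
    refine Finset.sum_congr rfl fun v _ => ?_
    rw [symContract_ι, Module.Dual.eval_apply, map_smul, Algebra.smul_def, mul_neg, mul_comm]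
  | mul a b ha hb =>
    have h : thetaSym x (a * b) = a * thetaSym x b + b * thetaSym x a := Derivation.leibniz _ _ _
    rw [h, ha, hb, Finset.mul_sum, Finset.mul_sum, ← Finset.sum_add_distrib]
    refine Finset.sum_congr rfl fun v _ => ?_
    rw [symContract_mul]
    ring
  | add a b ha hb =>
    simp only [map_add, ha, hb, neg_add, mul_add, Finset.sum_add_distrib]

/-- The matrix of the coadjoint action is transposed from the multiplication factor to the
contraction factor, where it becomes the bracket occurring in `Q`. -/
theorem thetaExt_eq_sum (x : ℓ) : thetaExt B x =
    -∑ v, extMul (B.coord v) ∘ₗ extContract (Module.Dual.eval K ℓ ⁅x, B v⁆) := by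
  have h1 (v : ι) : extMul (K := K) ⁅x, B.coord v⁆ =
      -∑ w, B.coord v ⁅x, B w⁆ • extMul (B.coord w) := by
    change extMulHom _ = -∑ w, B.coord v ⁅x, B w⁆ • extMulHom (B.coord w)
    rw [lie_dual_eq_sum B, map_neg, map_sum]
    simp only [map_smul]
  have h2 (w : ι) : extContract (Module.Dual.eval K ℓ ⁅x, B w⁆) =
      ∑ v, B.coord v ⁅x, B w⁆ • extContract (Module.Dual.eval K ℓ (B v)) := by
    change extContractHom _ =
      ∑ v, B.coord v ⁅x, B w⁆ • extContractHom (Module.Dual.eval K ℓ (B v))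
    conv_lhs => rw [← B.sum_repr ⁅x, B w⁆]
    simp only [map_sum, map_smul, Module.Basis.coord_apply]
  rw [thetaExt]
  simp only [h1, h2]
  exact sum_neg_sum_comp _ _ _ _

end Classical

section Ext

variable {K : Type*} [Field K] {ℓ : Type*} [LieRing ℓ] [LieAlgebra K ℓ]
  {ι : Type*} [Fintype ι] (B : Module.Basis ι K ℓ)

/-- Anticommuting the two multiplications absorbs the sign and gives the order `c^{v'} c^{u'}
b^{[u,v]}` of the zero-mode part of `Q`. -/
theorem extMul_thetaExt (f : Module.Dual K ℓ) (x : ℓ) : extMul f ∘ₗ thetaExt B x =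
    ∑ v, extMul (B.coord v) ∘ₗ extMul f ∘ₗ extContract (Module.Dual.eval K ℓ ⁅x, B v⁆) := by
  rw [thetaExt_eq_sum]
  exact comp_neg_sum _ _ _ _ fun v q => extMul_extMul _ _ q

end Ext

/-! ### Operators on tensor products and their intertwiners. -/

section Tensor

variable {K : Type*} [Field K] {S E S' E' : Type*} [AddCommGroup S] [Module K S]
  [AddCommGroup E] [Module K E] [AddCommGroup S'] [Module K S'] [AddCommGroup E'] [Module K E']

/-- The operators that preserve a subspace. -/
def stabilizer (p : Submodule K S) : Submodule K (Module.End K S) where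
  carrier := {T | ∀ w ∈ p, T w ∈ p}
  add_mem' hS hT w hw := p.add_mem (hS w hw) (hT w hw)
  zero_mem' _ _ := p.zero_mem
  smul_mem' r _ hT w hw := p.smul_mem r (hT w hw)

theorem map_left_map {i : S →ₗ[K] S'} {j : E →ₗ[K] E'} {T : Module.End K S'} {T' : Module.End K S}
    (h : ∀ p, T (i p) = i (T' p)) (a : S ⊗[K] E) :
    TensorProduct.map T LinearMap.id (TensorProduct.map i j a) =
      TensorProduct.map i j (TensorProduct.map T' LinearMap.id a) := by
  have h' : T ∘ₗ i = i ∘ₗ T' := LinearMap.ext h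
  rw [← LinearMap.comp_apply, ← LinearMap.comp_apply, ← TensorProduct.map_comp,
    ← TensorProduct.map_comp, h', LinearMap.id_comp, LinearMap.comp_id]

theorem map_right_map {i : S →ₗ[K] S'} {j : E →ₗ[K] E'} {T : Module.End K E'}
    {T' : Module.End K E} (h : ∀ p, T (j p) = j (T' p)) (a : S ⊗[K] E) :
    TensorProduct.map LinearMap.id T (TensorProduct.map i j a) =
      TensorProduct.map i j (TensorProduct.map LinearMap.id T' a) := by
  have h' : T ∘ₗ j = j ∘ₗ T' := LinearMap.ext h
  rw [← LinearMap.comp_apply, ← LinearMap.comp_apply, ← TensorProduct.map_comp,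
    ← TensorProduct.map_comp, h', LinearMap.id_comp, LinearMap.comp_id]

theorem map_injective_of_leftInverse {i : S →ₗ[K] S'} {j : E →ₗ[K] E'} {i' : S' →ₗ[K] S}
    {j' : E' →ₗ[K] E} (hi : ∀ p, i' (i p) = p) (hj : ∀ q, j' (j q) = q) :
    Function.Injective (TensorProduct.map i j) := by
  refine Function.LeftInverse.injective (g := TensorProduct.map i' j') fun a => ?_
  have hi' : i' ∘ₗ i = LinearMap.id := LinearMap.ext hi
  have hj' : j' ∘ₗ j = LinearMap.id := LinearMap.ext hj
  rw [← LinearMap.comp_apply, ← TensorProduct.map_comp, hi', hj', TensorProduct.map_id,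
    LinearMap.id_apply]

theorem map_left_map_right (x : Module.End K S) (y : Module.End K E) (a : S ⊗[K] E) :
    TensorProduct.map x LinearMap.id (TensorProduct.map LinearMap.id y a) =
      TensorProduct.map x y a :=
  LinearMap.congr_fun (rTensor_mul_lTensor x y) a

theorem sum_map_left {ι : Type*} (s : Finset ι) (x y : ι → Module.End K S) (e : Module.End K E)
    (a : S ⊗[K] E) : ∑ v ∈ s, TensorProduct.map (x v) LinearMap.id (TensorProduct.map (y v)
      LinearMap.id (TensorProduct.map LinearMap.id e a)) =
      TensorProduct.map (∑ v ∈ s, x v ∘ₗ y v) e a := by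
  induction a using TensorProduct.induction_on with
  | zero => simp only [map_zero, Finset.sum_const_zero]
  | add a b ha hb => simp only [map_add, Finset.sum_add_distrib, ha, hb]
  | tmul p q =>
    simp only [TensorProduct.map_tmul, LinearMap.id_apply, LinearMap.sum_apply,
      TensorProduct.sum_tmul, LinearMap.comp_apply]

theorem sum_map_right {ι : Type*} (s : Finset ι) (x z : ι → Module.End K E) (y : Module.End K E)
    (a : S ⊗[K] E) : ∑ v ∈ s, TensorProduct.map LinearMap.id (x v)
      (TensorProduct.map LinearMap.id y (TensorProduct.map LinearMap.id (z v) a)) =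
      TensorProduct.map LinearMap.id (∑ v ∈ s, x v ∘ₗ y ∘ₗ z v) a := by
  induction a using TensorProduct.induction_on with
  | zero => simp only [map_zero, Finset.sum_const_zero]
  | add a b ha hb => simp only [map_add, Finset.sum_add_distrib, ha, hb]
  | tmul p q =>
    simp only [TensorProduct.map_tmul, LinearMap.id_apply, LinearMap.sum_apply,
      TensorProduct.tmul_sum, LinearMap.comp_apply]

end Tensor

/-! ### Identification of the concrete operators with those of the mode representation. -/

section Fock

variable {K : Type*} [Field K] {ℓ : Type*} [LieRing ℓ] [LieAlgebra K ℓ]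

theorem fockRep_beta (n : ℤ) (x : ℓ) :
    (fockRep K ℓ).beta n x = TensorProduct.map (betaMode K x n) LinearMap.id := by
  rw [← betaHom_apply]
  rfl

theorem fockRep_gamma (n : ℤ) (f : Module.Dual K ℓ) :
    (fockRep K ℓ).gamma n f = TensorProduct.map (gammaMode f n) LinearMap.id := by
  rw [← gammaHom_apply]
  rfl

theorem fockRep_b (n : ℤ) (x : ℓ) :
    (fockRep K ℓ).b n x = TensorProduct.map LinearMap.id (bMode K x n) := by
  rw [← bHom_apply]
  rfl

theorem fockRep_c (n : ℤ) (f : Module.Dual K ℓ) :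
    (fockRep K ℓ).c n f = TensorProduct.map LinearMap.id (cMode f n) := by
  rw [← cHom_apply]
  rfl

theorem fockRep_normalBetaGamma (x : ℓ) (m : ℤ) (f : Module.Dual K ℓ) (n : ℤ) :
    (fockRep K ℓ).normalBetaGamma x m f n =
      TensorProduct.map (normalBetaGamma x m f n) LinearMap.id := by
  rw [ModeRep.normalBetaGamma, normalBetaGamma, fockRep_beta, fockRep_gamma]
  split_ifs
  · exact (LinearMap.rTensor_comp _ _ _).symm
  · exact (LinearMap.rTensor_comp _ _ _).symm

theorem fockRep_normalBC (x : ℓ) (m : ℤ) (f : Module.Dual K ℓ) (n : ℤ) :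
    (fockRep K ℓ).normalBC x m f n =
      TensorProduct.map LinearMap.id (normalBC x m f n) := by
  rw [ModeRep.normalBC, normalBC, fockRep_b, fockRep_c]
  split_ifs
  · refine Eq.trans ?_ (LinearMap.lTensor_neg _).symm
    exact congrArg Neg.neg (LinearMap.lTensor_comp _ _ _).symm
  · exact (LinearMap.lTensor_comp _ _ _).symm

theorem fockRep_normalBCC (x : ℓ) (m : ℤ) (f : Module.Dual K ℓ) (n : ℤ) (g : Module.Dual K ℓ)
    (p : ℤ) : (fockRep K ℓ).normalBCC x m f n g p =
      TensorProduct.map LinearMap.id (normalBCC x m f n g p) := by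
  rw [ModeRep.normalBCC, normalBCC, fockRep_b, fockRep_c, fockRep_c]
  split_ifs
  · rw [mul_assoc]
    exact ((LinearMap.lTensor_comp _ _ _).trans
      (congrArg _ (LinearMap.lTensor_comp _ _ _))).symm
  · rw [mul_assoc]
    exact ((LinearMap.lTensor_comp _ _ _).trans
      (congrArg _ (LinearMap.lTensor_comp _ _ _))).symm

variable {ι : Type*} (B : Module.Basis ι K ℓ)

theorem virTermBC_eq : virTermBC B = (fockRep K ℓ).virBC B fun n => -(n : K) := by
  ext1 a
  rw [virTermBC, ModeRep.virBC, fockRep_normalBC, TensorProduct.map_smul_right]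

theorem virTermBetaGamma_eq :
    virTermBetaGamma B = (fockRep K ℓ).virBetaGamma B fun n => -(n : K) := by
  ext1 a
  rw [virTermBetaGamma, ModeRep.virBetaGamma, fockRep_normalBetaGamma,
    TensorProduct.map_smul_left]

theorem qTermSym_eq : qTermSym B = (fockRep K ℓ).qSym B := by
  ext1 a
  rw [qTermSym, ModeRep.qSym, fockRep_normalBetaGamma, fockRep_c]
  exact (rTensor_mul_lTensor _ _).symm

theorem qTermExt_eq : qTermExt B = (fockRep K ℓ).qExt B := by
  ext1 a
  rw [qTermExt, ModeRep.qExt, fockRep_normalBCC]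

theorem hTerm_eq : hTerm B = (fockRep K ℓ).hFamily B := by
  ext1 a
  rw [hTerm, ModeRep.hFamily, fockRep_gamma, fockRep_b]
  exact (rTensor_mul_lTensor _ _).symm

theorem kTerm_eq : kTerm B = (fockRep K ℓ).kFamily B fun n => (n : K) := by
  ext1 a
  rw [kTerm, ModeRep.kFamily, fockRep_beta, fockRep_c]
  exact congrArg _ (rTensor_mul_lTensor _ _).symm

theorem semiInfH_eq : semiInfH B = (fockRep K ℓ).h B := by
  rw [semiInfH, hTerm_eq, ModeRep.h]

theorem semiInfK_eq : semiInfK B = (fockRep K ℓ).k B fun n => (n : K) := by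
  rw [semiInfK, kTerm_eq, ModeRep.k]

theorem semiInfH_homotopy (φ : ℤ → K) :
    semiInfH B * (fockRep K ℓ).k B φ + (fockRep K ℓ).k B φ * semiInfH B =
      (fockRep K ℓ).weight B φ := by
  rw [semiInfH_eq, ModeRep.weight]

variable [Fintype ι]

theorem virZero_eq : virZero B = (fockRep K ℓ).weight B fun n => -(n : K) := by
  rw [virZero, virTermBC_eq, virTermBetaGamma_eq, ModeRep.localSum_vir]

theorem semiInfQ_eq [CharZero K] : semiInfQ B = (1 / 2 : K) • (fockRep K ℓ).Q B := by
  rw [semiInfQ, qTermSym_eq, qTermExt_eq, ← ModeRep.localSum_q, smul_add, ← two_smul K, smul_smul,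
    one_div, inv_mul_cancel₀ two_ne_zero, one_smul, add_comm]

/-! ### The zero modes -/

theorem zeroModes_eq (f : Module.Dual K ℓ) : zeroModes K ℓ f = createDual f 0 := rfl

variable (K ℓ) in
/-- The inclusion of `Λℓ'` in the exterior module. -/
abbrev extZeroModes : ExteriorAlgebra K (Module.Dual K ℓ) →ₐ[K] ExtModule K ℓ :=
  ExteriorAlgebra.map (zeroModes K ℓ)

theorem extContract_extZeroModes (φ : Module.Dual K (Creation K ℓ))
    (q : ExteriorAlgebra K (Module.Dual K ℓ)) : extContract φ (extZeroModes K ℓ q) =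
      extZeroModes K ℓ (extContract (φ ∘ₗ zeroModes K ℓ) q) :=
  extContract_map _ _ _

theorem pairVec_comp_zeroModes (x : ℓ) (m : ℕ) : pairVec K x m ∘ₗ zeroModes K ℓ =
    if m = 0 then Module.Dual.eval K ℓ x else 0 := by
  ext f
  rw [LinearMap.comp_apply, zeroModes_eq, pairVec_createDual]
  split_ifs with h1 h2 h2
  · rfl
  · simp at h1
    omega
  · simp at h1
    omega
  · rfl

theorem pairDual_comp_zeroModes (f : Module.Dual K ℓ) (m : ℕ) :
    pairDual f m ∘ₗ zeroModes K ℓ = 0 := by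
  ext g
  exact pairDual_createDual _ _ _ _

theorem symContract_zero {V : Type*} [AddCommMonoid V] [Module K V] :
    symContract (0 : Module.Dual K V) = 0 :=
  (symContractHom (K := K) (V := V)).map_zero

theorem extContract_zero {V : Type*} [AddCommGroup V] [Module K V] :
    extContract (0 : Module.Dual K V) = 0 :=
  (extContractHom (K := K) (V := V)).map_zero

/-- Contraction is natural in the linear form, and on the zero modes the form attached to a vector
mode vanishes at positive index, that attached to a dual mode at every index. -/
theorem isBounded_tmul (p : SymmetricAlgebra K (Module.Dual K ℓ))
    (q : ExteriorAlgebra K (Module.Dual K ℓ)) :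
    (fockRep K ℓ).IsBounded 1 (classicalInclusion K ℓ (p ⊗ₜ q)) := by
  have hs (x : ℓ) (m : ℕ) : symContract (pairVec K x (m + 1)) (symMap (zeroModes K ℓ) p) = 0 := by
    rw [symContract_symMap, pairVec_comp_zeroModes, if_neg (Nat.succ_ne_zero m), symContract_zero,
      LinearMap.zero_apply, map_zero]
  have he (x : ℓ) (m : ℕ) :
      extContract (pairVec K x (m + 1)) (extZeroModes K ℓ q) = 0 := by
    rw [extContract_extZeroModes, pairVec_comp_zeroModes, if_neg (Nat.succ_ne_zero m), extContract_zero,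
      LinearMap.zero_apply, map_zero]
  refine ⟨le_rfl, fun n hn => ?_⟩
  obtain ⟨m, rfl⟩ : ∃ m : ℕ, n = Int.ofNat (m + 1) := ⟨(n - 1).toNat, by simp; omega⟩
  refine ⟨fun x => ?_, fun f => ?_, fun x => ?_, fun f => ?_⟩
  · rw [fockRep_beta, classicalInclusion, TensorProduct.map_tmul, TensorProduct.map_tmul]
    change (-symContract (pairVec K x (m + 1)) (symMap (zeroModes K ℓ) p)) ⊗ₜ[K] _ = _
    rw [hs, neg_zero, TensorProduct.zero_tmul]
  · rw [fockRep_gamma, classicalInclusion, TensorProduct.map_tmul, TensorProduct.map_tmul,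
      show Int.ofNat (m + 1) = -Int.negSucc m from rfl, gammaMode_neg_negSucc]
    change (symContract (pairDual f m) (symMap (zeroModes K ℓ) p)) ⊗ₜ[K] _ = _
    rw [symContract_symMap, pairDual_comp_zeroModes, symContract_zero, LinearMap.zero_apply,
      map_zero, TensorProduct.zero_tmul]
  · rw [fockRep_b, classicalInclusion, TensorProduct.map_tmul, TensorProduct.map_tmul]
    change _ ⊗ₜ[K] (extContract (pairVec K x (m + 1)) (extZeroModes K ℓ q)) = _
    rw [he, TensorProduct.tmul_zero]
  · rw [fockRep_c, classicalInclusion, TensorProduct.map_tmul, TensorProduct.map_tmul,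
      show Int.ofNat (m + 1) = -Int.negSucc m from rfl, cMode_neg_negSucc]
    change _ ⊗ₜ[K] (extContract (pairDual f m) (extZeroModes K ℓ q)) = _
    rw [extContract_extZeroModes, pairDual_comp_zeroModes, extContract_zero, LinearMap.zero_apply,
      map_zero, TensorProduct.tmul_zero]

theorem isBounded_classicalInclusion (a : ClassicalWeil K ℓ) :
    (fockRep K ℓ).IsBounded 1 (classicalInclusion K ℓ a) := by
  induction a using TensorProduct.induction_on with
  | zero => exact ⟨le_rfl, fun n _ => by simp⟩
  | tmul p q => exact isBounded_tmul p q
  | add a b ha hb =>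
    refine ⟨le_rfl, fun n hn => ?_⟩
    have h1 := ha.2 n hn
    have h2 := hb.2 n hn
    simp [h1, h2]

theorem beta_zero_classicalInclusion (x : ℓ) (a : ClassicalWeil K ℓ) :
    (fockRep K ℓ).beta 0 x (classicalInclusion K ℓ a) = classicalInclusion K ℓ
      (TensorProduct.map (-symContract (Module.Dual.eval K ℓ x)) LinearMap.id a) := by
  rw [fockRep_beta]
  refine map_left_map (fun p => ?_) a
  change -symContract (pairVec K x 0) (symMap (zeroModes K ℓ) p) = symMap (zeroModes K ℓ) (-_)
  rw [symContract_symMap, pairVec_comp_zeroModes, if_pos rfl, map_neg]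

theorem gamma_zero_classicalInclusion (f : Module.Dual K ℓ) (a : ClassicalWeil K ℓ) :
    (fockRep K ℓ).gamma 0 f (classicalInclusion K ℓ a) = classicalInclusion K ℓ
      (TensorProduct.map (symMul f) LinearMap.id a) := by
  rw [fockRep_gamma]
  refine map_left_map (fun p => ?_) a
  change SymmetricAlgebra.ι K _ (zeroModes K ℓ f) * symMap (zeroModes K ℓ) p =
    symMap (zeroModes K ℓ) (SymmetricAlgebra.ι K _ f * p)
  rw [map_mul, SymmetricAlgebra.lift_ι_apply, LinearMap.comp_apply]

theorem b_zero_classicalInclusion (x : ℓ) (a : ClassicalWeil K ℓ) :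
    (fockRep K ℓ).b 0 x (classicalInclusion K ℓ a) = classicalInclusion K ℓ
      (TensorProduct.map LinearMap.id (extContract (Module.Dual.eval K ℓ x)) a) := by
  rw [fockRep_b]
  refine map_right_map (fun q => ?_) a
  change extContract (pairVec K x 0) (extZeroModes K ℓ q) = extZeroModes K ℓ _
  rw [extContract_extZeroModes, pairVec_comp_zeroModes, if_pos rfl]

theorem c_zero_classicalInclusion (f : Module.Dual K ℓ) (a : ClassicalWeil K ℓ) :
    (fockRep K ℓ).c 0 f (classicalInclusion K ℓ a) = classicalInclusion K ℓ
      (TensorProduct.map LinearMap.id (extMul f) a) := by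
  rw [fockRep_c]
  refine map_right_map (fun q => ?_) a
  change ExteriorAlgebra.ι K (zeroModes K ℓ f) * extZeroModes K ℓ q =
    extZeroModes K ℓ (ExteriorAlgebra.ι K f * q)
  refine Eq.trans ?_ (map_mul (extZeroModes K ℓ) _ _).symm
  exact congrArg (· * _) (ExteriorAlgebra.map_apply_ι _ _).symm

theorem semiInfH_classicalInclusion :
    semiInfH B ∘ₗ classicalInclusion K ℓ = classicalInclusion K ℓ ∘ₗ classicalH B := by
  refine LinearMap.ext fun a => ?_
  rw [LinearMap.comp_apply, LinearMap.comp_apply, semiInfH_eq,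
    (isBounded_classicalInclusion a).h_apply, classicalH, LinearMap.sum_apply, map_sum]
  refine Finset.sum_congr rfl fun u _ => ?_
  rw [b_zero_classicalInclusion, gamma_zero_classicalInclusion, map_left_map_right]

theorem semiInfK_classicalInclusion (a : ClassicalWeil K ℓ) :
    semiInfK B (classicalInclusion K ℓ a) = 0 := by
  rw [semiInfK_eq]
  exact (isBounded_classicalInclusion a).k_apply B (by simp)

theorem qTermSym_classicalInclusion (a : ClassicalWeil K ℓ) :
    localSum (qTermSym B) (classicalInclusion K ℓ a) = classicalInclusion K ℓ
      ((∑ u, TensorProduct.map (thetaSym (B u)) (extMul (B.coord u))) a) := by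
  rw [qTermSym_eq, (isBounded_classicalInclusion a).localSum_qSym_apply, LinearMap.sum_apply,
    map_sum]
  refine Finset.sum_congr rfl fun u _ => ?_
  rw [thetaSym_eq_sum B, ← sum_map_left, map_sum]
  refine Finset.sum_congr rfl fun v _ => ?_
  rw [c_zero_classicalInclusion, beta_zero_classicalInclusion, gamma_zero_classicalInclusion]

theorem qTermExt_classicalInclusion (a : ClassicalWeil K ℓ) :
    localSum (qTermExt B) (classicalInclusion K ℓ a) = classicalInclusion K ℓ
      ((∑ u, TensorProduct.map LinearMap.id (extMul (B.coord u) ∘ₗ thetaExt B (B u))) a) := by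
  rw [qTermExt_eq, (isBounded_classicalInclusion a).localSum_qExt_apply, LinearMap.sum_apply,
    map_sum]
  refine Finset.sum_congr rfl fun u _ => ?_
  rw [extMul_thetaExt, ← sum_map_right, map_sum]
  refine Finset.sum_congr rfl fun v _ => ?_
  rw [b_zero_classicalInclusion, c_zero_classicalInclusion, c_zero_classicalInclusion]

theorem semiInfQ_classicalInclusion :
    semiInfQ B ∘ₗ classicalInclusion K ℓ = classicalInclusion K ℓ ∘ₗ classicalD B := by
  refine LinearMap.ext fun a => ?_
  rw [LinearMap.comp_apply, LinearMap.comp_apply, semiInfQ, LinearMap.add_apply,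
    LinearMap.smul_apply, qTermSym_classicalInclusion, qTermExt_classicalInclusion, ← map_smul,
    ← map_add]
  rfl

/-- The creation operators retract linearly onto the zero modes, and functoriality of both algebras
turns the retraction into a left inverse. -/
theorem classicalInclusion_injective : Function.Injective (classicalInclusion K ℓ) := by
  let r : Creation K ℓ →ₗ[K] Module.Dual K ℓ := Finsupp.lapply 0 ∘ₗ LinearMap.fst K _ _
  have hr : r ∘ₗ zeroModes K ℓ = LinearMap.id := by
    ext1 f
    simp [r, zeroModes]
  have hs : (symMap r).comp (symMap (zeroModes K ℓ)) = AlgHom.id K _ := by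
    apply SymmetricAlgebra.algHom_ext
    ext1 f
    have := LinearMap.congr_fun hr f
    simp only [LinearMap.comp_apply, LinearMap.id_apply] at this
    simp [this]
  have he : (ExteriorAlgebra.map r : ExtModule K ℓ →ₐ[K] _).comp (extZeroModes K ℓ) =
      AlgHom.id K _ :=
    (ExteriorAlgebra.map_comp_map _ _).trans (by rw [hr, ExteriorAlgebra.map_id])
  have hs' (p) : symMap r (symMap (zeroModes K ℓ) p) = p := DFunLike.congr_fun hs p
  have he' (q) : (ExteriorAlgebra.map r : ExtModule K ℓ →ₐ[K] _) (extZeroModes K ℓ q) = q :=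
    DFunLike.congr_fun he q
  exact map_injective_of_leftInverse (i' := (symMap r).toLinearMap)
    (j' := (ExteriorAlgebra.map r : ExtModule K ℓ →ₐ[K] _).toLinearMap) hs' he'

/-! ### Semisimplicity of the weight operators -/

theorem creation_submodule_eq_top (q : Submodule K (Creation K ℓ))
    (dual : ∀ f m, createDual f m ∈ q) (vec : ∀ x m, createVec K x m ∈ q) : q = ⊤ := by
  have h1 (F : ℕ →₀ Module.Dual K ℓ) : (F, 0) ∈ q := by
    induction F using Finsupp.induction_linear with
    | zero => exact q.zero_mem
    | add F G hF hG => simpa using q.add_mem hF hG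
    | single m f => exact dual f m
  have h2 (F : ℕ →₀ ℓ) : (0, F) ∈ q := by
    induction F using Finsupp.induction_linear with
    | zero => exact q.zero_mem
    | add F G hF hG => simpa using q.add_mem hF hG
    | single m f => exact vec f m
  rw [eq_top_iff]
  rintro v -
  simpa using q.add_mem (h1 v.1) (h2 v.2)

/-- The generators whose multiplication preserves `p` form a subspace. It contains the creation
modes, which span, so `p` is stable under multiplication by every generator. -/
theorem fockRep_isCyclic : (fockRep K ℓ).IsCyclic (vacuum K ℓ) := by
  intro p h1 hβ hb hγ hc
  simp only [fockRep_beta, fockRep_b, fockRep_gamma, fockRep_c, gammaMode_neg_ofNat,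
    cMode_neg_ofNat] at hβ hb hγ hc
  have hs := creation_submodule_eq_top ((stabilizer p).comap
    (LinearMap.rTensorHom (ExtModule K ℓ) ∘ₗ symMulHom (K := K) (V := Creation K ℓ)))
    (fun f m => hγ m f) (fun x m => hβ m x)
  have he := creation_submodule_eq_top ((stabilizer p).comap
    (LinearMap.lTensorHom (SymModule K ℓ) ∘ₗ extMulHom (K := K) (V := Creation K ℓ)))
    (fun f m => hc m f) (fun x m => hb m x)
  exact sym_ext_cyclic (V := Creation K ℓ) p h1
    (fun v w hw => Submodule.eq_top_iff'.1 hs v w hw)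
    (fun v w hw => Submodule.eq_top_iff'.1 he v w hw)

theorem classicalInclusion_one : classicalInclusion K ℓ 1 = vacuum K ℓ := by
  rw [Algebra.TensorProduct.one_def, classicalInclusion, TensorProduct.map_tmul,
    AlgHom.toLinearMap_apply, AlgHom.toLinearMap_apply, map_one, map_one, vacuum]

/-- The weights are `m + 1` for `β_{-m-1}`, `b_{-m-1}` and `m` for `γ_{-m}`, `c_{-m}`. Weight zero
occurs only for `γ_0`, `c_0`, which preserve `Wℓ`. -/
theorem isKernelSplit_virZero [CharZero K] :
    IsKernelSplit (classicalInclusion K ℓ) (virZero B) := by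
  rw [virZero_eq]
  refine fockRep_isCyclic.isKernelSplit_weight B classicalInclusion_injective _ (fun a => ?_)
    ⟨1, classicalInclusion_one⟩ (fun m => ⟨m, by simp⟩) fun m => ⟨m, by simp, ?_⟩
  · exact (isBounded_classicalInclusion a).weight_apply B (by simp)
  · rintro rfl f a
    rw [show -Int.ofNat 0 = 0 from rfl, gamma_zero_classicalInclusion, c_zero_classicalInclusion]
    exact ⟨⟨_, rfl⟩, ⟨_, rfl⟩⟩

theorem semiInfH_vacuum : semiInfH B (vacuum K ℓ) = 0 := by
  rw [semiInfH_eq, ← classicalInclusion_one, (isBounded_classicalInclusion 1).h_apply]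
  refine Finset.sum_eq_zero fun u _ => ?_
  rw [classicalInclusion_one, fockRep_b, vacuum, TensorProduct.map_tmul, bMode_one _ _ le_rfl,
    TensorProduct.tmul_zero, map_zero]

/-- The coefficients of the homotopy operator whose weight operator counts the generators. -/
def numberCoeff (K : Type*) [Field K] (n : ℤ) : K := if 0 ≤ n then -1 else 1

theorem k_numberCoeff_vacuum : (fockRep K ℓ).k B (numberCoeff K) (vacuum K ℓ) = 0 := by
  rw [ModeRep.k, localSum_apply_eq_sum ((fockRep K ℓ).isLocallyFinite_kFamily B _) ∅,
    Finset.sum_empty]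
  intro a _
  rw [ModeRep.kFamily, LinearMap.smul_apply, fockRep_beta, fockRep_c]
  refine smul_eq_zero_of_right _ ?_
  rw [Module.End.mul_apply, vacuum, TensorProduct.map_tmul, TensorProduct.map_tmul,
    LinearMap.id_apply, LinearMap.id_apply]
  by_cases h : 0 ≤ a.2
  · rw [betaMode_one _ _ h, TensorProduct.zero_tmul]
  · rw [cMode_one _ _ (by omega), TensorProduct.tmul_zero]

theorem vacuum_ne_zero : vacuum K ℓ ≠ 0 := by
  rw [← classicalInclusion_one]
  exact (map_ne_zero_iff _ classicalInclusion_injective).2 one_ne_zero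

/-- With these coefficients every creation operator has weight one, so nothing but multiples of the
vacuum has weight zero. -/
theorem isKernelSplit_number [CharZero K] :
    IsKernelSplit (LinearMap.toSpanSingleton K (SemiInfWeil K ℓ) (vacuum K ℓ))
      ((fockRep K ℓ).weight B (numberCoeff K)) := by
  refine fockRep_isCyclic.isKernelSplit_weight B ?_ _ (fun a => ?_) ⟨1, by simp⟩ (fun m => ⟨0, ?_⟩)
    fun m => ⟨1, ?_, fun h => absurd h one_ne_zero⟩
  · exact smul_left_injective K vacuum_ne_zero
  · rw [LinearMap.toSpanSingleton_apply, map_smul, ModeRep.weight, LinearMap.add_apply,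
      Module.End.mul_apply, Module.End.mul_apply, k_numberCoeff_vacuum, ← semiInfH_eq,
      semiInfH_vacuum, map_zero, map_zero, add_zero, smul_zero]
  · simp [numberCoeff]
  · simp [numberCoeff]

end Fock

/-- The case of the zero differential on `U`, whose cohomology is `U` itself. -/
theorem IsKernelSplit.mk_bijective {K U W : Type*} [Field K] [AddCommGroup U] [Module K U]
    [AddCommGroup W] [Module K W] {i : U →ₗ[K] W} {L : Module.End K W} (h : IsKernelSplit i L)
    {D s : Module.End K W} (hd : ∀ a, D (i a) = 0) (hD : D * D = 0) (hs : D * s + s * D = L) :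
    Function.Bijective fun a => Cohomology.mk D (i a) (hd a) := by
  have h1 : D ∘ₗ i = i ∘ₗ (0 : Module.End K U) := by
    ext a
    simp [hd]
  have h2 : Function.Bijective fun a : U =>
      Cohomology.mk (0 : Module.End K U) a (LinearMap.zero_apply a) := by
    refine ⟨fun a b hab => ?_, fun c => ?_⟩
    · obtain ⟨v, hv⟩ := (Cohomology.mk_eq_mk _ _).1 hab
      rw [LinearMap.zero_apply] at hv
      exact sub_eq_zero.1 hv.symm
    · obtain ⟨a, _, rfl⟩ := Cohomology.mk_surjective c
      exact ⟨a, rfl⟩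
  exact (h.cohomologyMap_bijective h1 hD hs).comp h2

namespace ModeRep

variable {K ℓ W : Type*} [Field K] [LieRing ℓ] [LieAlgebra K ℓ] [AddCommGroup W]
    [Module K W] (M : ModeRep K ℓ W) {ι : Type*} [Fintype ι] (B : Module.Basis ι K ℓ)

/-- The roles of `h` and `k` are exchanged: `-h` is a homotopy for `k`. The sign is the one that
yields `L₀` for `φ(n) = n`. -/
theorem k_homotopy (φ : ℤ → K) :
    M.k B φ * (-M.h B) + (-M.h B) * M.k B φ = M.weight B fun n => -φ n := by
  have h1 : M.k B (fun n => -φ n) = -M.k B φ := by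
    rw [k, k, ← localSum_neg (M.isLocallyFinite_kFamily B φ)]
    congr 1
    ext1 a
    rw [kFamily, kFamily, neg_smul]
  rw [weight, h1]
  noncomm_ring

theorem smul_Q_sq [CharZero K] (r : K) : (r • M.Q B) ∘ₗ (r • M.Q B) = 0 := by
  rw [LinearMap.smul_comp, LinearMap.comp_smul, ← Module.End.mul_eq_comp, Q_sq, smul_zero,
    smul_zero]

theorem smul_Q_weight [CharZero K] (r : K) (φ : ℤ → K) (hφ : ∀ m n, φ (m + n) = φ m + φ n) :
    (r • M.Q B) ∘ₗ M.weight B φ = M.weight B φ ∘ₗ (r • M.Q B) := by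
  rw [LinearMap.smul_comp, LinearMap.comp_smul, ← Module.End.mul_eq_comp, ← weight_Q _ _ _ hφ]
  rfl

end ModeRep

/-! ### Squares, homotopies and the resulting cohomologies. -/

section Final

variable {K : Type*} [Field K] {ℓ : Type*} [LieRing ℓ] [LieAlgebra K ℓ]
  {ι : Type*} [Fintype ι] (B : Module.Basis ι K ℓ)

theorem semiInfQ_sq [CharZero K] : semiInfQ B ∘ₗ semiInfQ B = 0 := by
  rw [semiInfQ_eq]
  exact (fockRep K ℓ).smul_Q_sq B _

theorem semiInfH_sq [CharZero K] : semiInfH B ∘ₗ semiInfH B = 0 := by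
  rw [semiInfH_eq]
  exact (fockRep K ℓ).h_sq B

theorem semiInfK_sq [CharZero K] : semiInfK B ∘ₗ semiInfK B = 0 := by
  rw [semiInfK_eq]
  exact (fockRep K ℓ).k_sq B _

theorem semiInfQ_virZero [CharZero K] : semiInfQ B ∘ₗ virZero B = virZero B ∘ₗ semiInfQ B := by
  rw [semiInfQ_eq, virZero_eq]
  exact (fockRep K ℓ).smul_Q_weight B _ _ fun m n => by push_cast; ring

/-- Yields the squares of the classical differentials from those of `Q` and `h`, with no separate
computation in `Wℓ`. -/
theorem sq_eq_zero_of_intertwine {U W : Type*} [AddCommGroup U] [Module K U] [AddCommGroup W]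
    [Module K W] {i : U →ₗ[K] W} (hi : Function.Injective i) {d : Module.End K U}
    {D : Module.End K W} (h : D ∘ₗ i = i ∘ₗ d) (hD : D ∘ₗ D = 0) : d ∘ₗ d = 0 := by
  have h' (a : U) : D (i a) = i (d a) := LinearMap.congr_fun h a
  refine LinearMap.ext fun a => hi ?_
  rw [LinearMap.comp_apply, ← h', ← h', ← LinearMap.comp_apply, hD, LinearMap.zero_apply,
    LinearMap.zero_apply, map_zero]

theorem semiInfK_homotopy : semiInfK B * (-(fockRep K ℓ).h B) +
    (-(fockRep K ℓ).h B) * semiInfK B = virZero B := by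
  rw [semiInfK_eq, virZero_eq]
  exact (fockRep K ℓ).k_homotopy B _

theorem semiInfH_cohomologyMap_bijective [CharZero K] : Function.Bijective
    (cohomologyMap (classicalInclusion K ℓ) (semiInfH_classicalInclusion B)) :=
  (isKernelSplit_virZero B).cohomologyMap_bijective _ (semiInfH_sq B)
    ((semiInfH_homotopy B _).trans (virZero_eq B).symm)

theorem semiInfH_cohomology_vacuum [CharZero K] : Function.Bijective
    (fun r : K => r • Cohomology.mk (semiInfH B) (vacuum K ℓ) (semiInfH_vacuum B)) :=
  (isKernelSplit_number B).mk_bijective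
    (fun r => by rw [LinearMap.toSpanSingleton_apply, map_smul, semiInfH_vacuum, smul_zero])
    (semiInfH_sq B) (semiInfH_homotopy B _)

theorem classicalH_one : classicalH B (1 : ClassicalWeil K ℓ) = 0 := by
  apply classicalInclusion_injective
  have h := LinearMap.congr_fun (semiInfH_classicalInclusion B) (1 : ClassicalWeil K ℓ)
  rw [LinearMap.comp_apply, LinearMap.comp_apply, classicalInclusion_one, semiInfH_vacuum] at h
  rw [← h, map_zero]

/-- Transported back from the semi-infinite complex: there the vacuum spans the cohomology, and the
inclusion is an isomorphism on cohomology that takes `1` to the vacuum. -/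
theorem classicalH_cohomology_one [CharZero K] : Function.Bijective
    (fun r : K => r • Cohomology.mk (classicalH B) 1 (classicalH_one B)) := by
  rw [← (semiInfH_cohomologyMap_bijective B).of_comp_iff']
  convert semiInfH_cohomology_vacuum B using 1
  ext1 r
  rw [Function.comp_apply, map_smul, cohomologyMap_mk]
  congr 2
  exact classicalInclusion_one

end Final

end VOWA

end

theorem proposition3 {K : Type*} [Field K] [IsAlgClosed K] [CharZero K]
    {ℓ : Type*} [LieRing ℓ] [LieAlgebra K ℓ]
    {ι : Type*} [Fintype ι] (B : Module.Basis ι K ℓ) :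
    -- the infinite sums that define the operators make sense
    (VOWA.IsLocallyFinite (VOWA.virTermBC B) ∧ VOWA.IsLocallyFinite (VOWA.virTermBetaGamma B) ∧
      VOWA.IsLocallyFinite (VOWA.qTermSym B) ∧ VOWA.IsLocallyFinite (VOWA.qTermExt B) ∧
      VOWA.IsLocallyFinite (VOWA.hTerm B) ∧ VOWA.IsLocallyFinite (VOWA.kTerm B)) ∧
    -- the differentials are square-zero
    (VOWA.classicalD B ∘ₗ VOWA.classicalD B = 0 ∧ VOWA.classicalH B ∘ₗ VOWA.classicalH B = 0 ∧
      VOWA.semiInfQ B ∘ₗ VOWA.semiInfQ B = 0 ∧ VOWA.semiInfH B ∘ₗ VOWA.semiInfH B = 0 ∧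
      VOWA.semiInfK B ∘ₗ VOWA.semiInfK B = 0) ∧
    -- the degree-zero part is the classical Weil algebra
    (Function.Injective (VOWA.classicalInclusion K ℓ) ∧
      LinearMap.range (VOWA.classicalInclusion K ℓ) = LinearMap.ker (VOWA.virZero B)) ∧
    -- the cohomology of `Q` on the degree-zero part is that of `d`
    (∃ (hQ : ∀ w ∈ LinearMap.ker (VOWA.virZero B),
          VOWA.semiInfQ B w ∈ LinearMap.ker (VOWA.virZero B))
        (hj : ∀ a, VOWA.classicalInclusion K ℓ a ∈ LinearMap.ker (VOWA.virZero B))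
        (hd : (VOWA.semiInfQ B).restrict hQ ∘ₗ
            (VOWA.classicalInclusion K ℓ).codRestrict _ hj =
          (VOWA.classicalInclusion K ℓ).codRestrict _ hj ∘ₗ VOWA.classicalD B),
      Function.Bijective (VOWA.cohomologyMap
        (W := LinearMap.ker (VOWA.virZero B))
        ((VOWA.classicalInclusion K ℓ).codRestrict _ hj) hd)) ∧
    -- and it is the degree-zero part of the whole cohomology of `Q`
    (∃ (hd : VOWA.semiInfQ B ∘ₗ VOWA.classicalInclusion K ℓ =
          VOWA.classicalInclusion K ℓ ∘ₗ VOWA.classicalD B)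
        (hL : VOWA.semiInfQ B ∘ₗ VOWA.virZero B = VOWA.virZero B ∘ₗ VOWA.semiInfQ B),
      Function.Injective (VOWA.cohomologyMap (VOWA.classicalInclusion K ℓ) hd) ∧
      LinearMap.range (VOWA.cohomologyMap (VOWA.classicalInclusion K ℓ) hd) = LinearMap.ker (VOWA.cohomologyMap (VOWA.virZero B) hL)) ∧
    -- the cohomology of `h` is the classical one, and both are spanned by the unit (vacuum)
    (∃ hh : VOWA.semiInfH B ∘ₗ VOWA.classicalInclusion K ℓ =
          VOWA.classicalInclusion K ℓ ∘ₗ VOWA.classicalH B,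
      Function.Bijective (VOWA.cohomologyMap (VOWA.classicalInclusion K ℓ) hh)) ∧
    (∃ h1 : VOWA.classicalH B (1 : VOWA.ClassicalWeil K ℓ) = 0,
      Function.Bijective (fun r : K => r • VOWA.Cohomology.mk (VOWA.classicalH B) 1 h1)) ∧
    (∃ h1 : VOWA.semiInfH B (VOWA.vacuum K ℓ) = 0,
      Function.Bijective
        (fun r : K => r • VOWA.Cohomology.mk (VOWA.semiInfH B) (VOWA.vacuum K ℓ) h1)) ∧
    -- the cohomology of `k` is the classical Weil algebra
    (∃ hk : ∀ a, VOWA.semiInfK B (VOWA.classicalInclusion K ℓ a) = 0,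
      Function.Bijective (fun a : VOWA.ClassicalWeil K ℓ =>
        VOWA.Cohomology.mk (VOWA.semiInfK B) (VOWA.classicalInclusion K ℓ a) (hk a))) := by
  have hinj := VOWA.classicalInclusion_injective (K := K) (ℓ := ℓ)
  have hsplit := VOWA.isKernelSplit_virZero B
  have hQi := VOWA.semiInfQ_classicalInclusion B
  have hQL := VOWA.semiInfQ_virZero B
  refine ⟨⟨?_, ?_, ?_, ?_, ?_, ?_⟩, ⟨?_, ?_, VOWA.semiInfQ_sq B, VOWA.semiInfH_sq B,
    VOWA.semiInfK_sq B⟩, ⟨hinj, hsplit.range_eq⟩, ⟨?_, hsplit.apply_zero, ?_, ?_⟩,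
    ⟨hQi, hQL, hsplit.cohomologyMap_injective hQi hQL, hsplit.range_cohomologyMap hQi hQL⟩,
    ⟨VOWA.semiInfH_classicalInclusion B, VOWA.semiInfH_cohomologyMap_bijective B⟩,
    ⟨VOWA.classicalH_one B, VOWA.classicalH_cohomology_one B⟩,
    ⟨VOWA.semiInfH_vacuum B, VOWA.semiInfH_cohomology_vacuum B⟩,
    ⟨VOWA.semiInfK_classicalInclusion B, hsplit.mk_bijective _ (VOWA.semiInfK_sq B)
      (VOWA.semiInfK_homotopy B)⟩⟩
  · rw [VOWA.virTermBC_eq]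
    exact (VOWA.fockRep K ℓ).isLocallyFinite_virBC B _
  · rw [VOWA.virTermBetaGamma_eq]
    exact (VOWA.fockRep K ℓ).isLocallyFinite_virBetaGamma B _
  · rw [VOWA.qTermSym_eq]
    exact (VOWA.fockRep K ℓ).isLocallyFinite_qSym B
  · rw [VOWA.qTermExt_eq]
    exact (VOWA.fockRep K ℓ).isLocallyFinite_qExt B
  · rw [VOWA.hTerm_eq]
    exact (VOWA.fockRep K ℓ).isLocallyFinite_hFamily B
  · rw [VOWA.kTerm_eq]
    exact (VOWA.fockRep K ℓ).isLocallyFinite_kFamily B _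
  · exact VOWA.sq_eq_zero_of_intertwine hinj hQi (VOWA.semiInfQ_sq B)
  · exact VOWA.sq_eq_zero_of_intertwine hinj (VOWA.semiInfH_classicalInclusion B)
      (VOWA.semiInfH_sq B)
  · intro w hw
    have h := LinearMap.congr_fun hQL w
    rw [LinearMap.comp_apply, LinearMap.comp_apply, LinearMap.mem_ker.1 hw, map_zero] at h
    exact h.symm
  · exact LinearMap.ext fun a => Subtype.ext (LinearMap.congr_fun hQi a)
  -- Onto the degree-zero part the inclusion is already an isomorphism of complexes, so no homotopy
  -- is needed.
  · refine VOWA.cohomologyMap_bijective_of_bijective _ _ ⟨fun a b h => ?_, fun w => ?_⟩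
    · exact hinj (congrArg Subtype.val h)
    · obtain ⟨a, ha⟩ : w.1 ∈ LinearMap.range (VOWA.classicalInclusion K ℓ) :=
        by
        rw [hsplit.range_eq]
        exact w.2
      exact ⟨a, Subtype.ext ha⟩
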